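/- Let $\psi:\mathbb{R}_{>0}\to\mathbb{R}_{>0}$ be a non-increasing function with $\sum_{t\in\mathbb{N}}\psi(t)=\infty$. Let $N\ge 1$ be an integer and let $p_0,q_0\in\mathbb{Z}$ satisfy $\gcd(p_0,q_0,N)=1$. Put \[ \zeta_N(2)=\prod_{p\ \text{prime},\ p\nmid N}\left(1-\frac1{p^2}\right)^{-1}. \] Then for Lebesgue-almost every $x\in\mathbb{R}$, as $T\to\infty$ (through the reals), \[ \#\left\{(p,q)\in\mathbb{Z}^2:\ \gcd(p,q)=1,\ (p,q)\equiv(p_0,q_0)\ (\mathrm{mod}\ N),\ 0<|q|\le T,\ |qx-p|<\psi(|q|)\right\}\ \sim\ \frac{4}{\zeta_N(2)N^2}\sum_{1\le t\le T}\psi(t), \] where $\sim$ means that the ratio of the two sides tends to $1$ and $t$ runs over integers. -/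

import Mathlib

open Filter MeasureTheory Asymptotics

/-- The partial zeta value `ζ_N(d) = ∏ (1 - p^{-d})⁻¹`, the product running over the primes `p`
that do not divide `N`. -/
noncomputable def zetaN (N d : ℕ) : ℝ :=
  ∏' p : {p : ℕ // p.Prime ∧ ¬ p ∣ N}, (1 - 1 / ((p : ℕ) : ℝ) ^ d)⁻¹

/-- The primitive integer vectors `(p, q)` with `(p, q) ≡ (p₀, q₀) (mod N)`, `0 < |q| ≤ T` and
`|q x - p| < ψ (|q|)`. The function `ψ` is only meaningful on the positive reals, which is why
`q ≠ 0`. -/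
def approxVectors (ψ : ℝ → ℝ) (p₀ q₀ : ℤ) (N : ℕ) (x T : ℝ) : Set (ℤ × ℤ) :=
  {v | Int.gcd v.1 v.2 = 1 ∧ v.1 ≡ p₀ [ZMOD N] ∧ v.2 ≡ q₀ [ZMOD N] ∧ v.2 ≠ 0 ∧
    |(v.2 : ℝ)| ≤ T ∧ |(v.2 : ℝ) * x - (v.1 : ℝ)| < ψ |(v.2 : ℝ)|}

/-! The proof is a second moment argument on the circle `ℝ/Nℤ`. Write f(q) = ψ(q), Ψ(n) = ∑_{q ≤ n}
f(q), and let c_q(x) be the number of admissible numerators for a denominator q > 0 (`approxCount`).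
Vectors with q < 0 become vectors with q > 0 in the class of (-p₀, -q₀) under negation, so each sign
contributes 2/(ζ_N(2)N²)·Ψ and together they give the constant 4.

Mean. For q ≡ q₀ mod N, the integral of c_q over a period is 2 f(q) `phiRatio N q`. Expanding
`phiRatio` as a Möbius sum gives its average over q (`tendsto_average_phiRatio`), and summation by
parts passes to the weight f (`PosAntitone.tendsto_weighted_average`).

Covariance. For r ≤ q, unfolding reduces ∫ c_q c_r to counting pairs of primitive vectors (p,q),
(p',r) whose determinant pr - p'q lies in an interval of length 2q f(r). Möbius inversion in both
vectors and the explicit count `exists_finset_pairs` give the expected main term, up to an error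
∑_{d∣q} ∑_{d'∣r} min(2 gcd(q,r), 2q f(r)/(dd')). A cutoff K splits this error: small divisors and
small gcd cost O(K³) before the factor 2f(q)/q, while large ones are rare on average because f is
non-increasing. The total variance of the sum up to n is O(K³Ψ + Ψ²/K)
(`PosAntitone.integral_sq_sub_le`).

Almost sure convergence. Along n_j with Ψ(n_j) ≈ j⁸ and K = j², the normalised variance is O(1/j²),
which is summable, so the ratio converges almost everywhere on this subsequence. Since (j+1)⁸/j⁸ → 1
and the counts are monotone, the limit extends to all n. -/

/-! ### Pairs of lattice vectors with small nonzero determinant -/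

theorem mem_Ioo_floor_ceil {α β : ℝ} {k : ℤ} :
    k ∈ Finset.Ioo ⌊α⌋ ⌈β⌉ ↔ α < k ∧ (k : ℝ) < β := by
  rw [Finset.mem_Ioo, Int.floor_lt, Int.lt_ceil]

theorem abs_card_Ioo_floor_ceil_sub_le {α β : ℝ} (h : α < β) :
    |((Finset.Ioo ⌊α⌋ ⌈β⌉).card : ℝ) - (β - α)| ≤ 1 := by
  have h1 : ⌊α⌋ < ⌈β⌉ := by
    rw [Int.lt_ceil]; exact (Int.floor_le α).trans_lt h
  have h2 : ((Finset.Ioo ⌊α⌋ ⌈β⌉).card : ℤ) = ⌈β⌉ - ⌊α⌋ - 1 := by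
    rw [Int.card_Ioo, Int.toNat_of_nonneg (by omega)]
  have h3 : ((Finset.Ioo ⌊α⌋ ⌈β⌉).card : ℝ) = ⌈β⌉ - ⌊α⌋ - 1 := by exact_mod_cast h2
  rw [h3, abs_le]
  constructor <;> linarith [Int.floor_le α, Int.lt_floor_add_one α, Int.le_ceil β,
    Int.ceil_lt_add_one β]

/-- Discarding 0 removes the additive constant from the count, so the bound stays useful for
arbitrarily short intervals around 0. -/
theorem card_erase_Ioo_floor_ceil_le {α β : ℝ} (hα : α < 0) (hβ : 0 < β) :
    (((Finset.Ioo ⌊α⌋ ⌈β⌉).erase 0).card : ℝ) ≤ β - α := by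
  have h0 : (0 : ℤ) ∈ Finset.Ioo ⌊α⌋ ⌈β⌉ := by
    rw [mem_Ioo_floor_ceil]; simpa using ⟨hα, hβ⟩
  have h1 := Finset.mem_Ioo.1 h0
  have h2 : (((Finset.Ioo ⌊α⌋ ⌈β⌉).erase 0).card : ℤ) = ⌈β⌉ - ⌊α⌋ - 2 := by
    rw [Finset.card_erase_of_mem h0, Int.card_Ioo]; omega
  have h3 : (((Finset.Ioo ⌊α⌋ ⌈β⌉).erase 0).card : ℝ) = ⌈β⌉ - ⌊α⌋ - 2 := by exact_mod_cast h2
  rw [h3]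
  linarith [Int.lt_floor_add_one α, Int.ceil_lt_add_one β]

/-- The number of `i` in a complete residue system modulo `g * b` in a fixed class modulo `b`. -/
theorem card_filter_modEq_mul {g b : ℕ} (hb : 0 < b) (c : ℤ) :
    ((Finset.Ico (0 : ℤ) (g * b : ℕ)).filter (fun i => i ≡ c [ZMOD b])).card = g := by
  have hb' : (0 : ℤ) < b := by exact_mod_cast hb
  have h := Int.Ico_filter_modEq_card 0 ((g * b : ℕ) : ℤ) hb' c
  have e : (((g * b : ℕ) : ℤ) - c : ℚ) / ((b : ℤ) : ℚ) = (((0:ℤ) : ℚ) - c) / ((b : ℤ) : ℚ) + (g : ℤ) := by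
    have : (b : ℚ) ≠ 0 := by positivity
    push_cast; field_simp; ring
  rw [e, Int.ceil_add_intCast] at h
  have : (((Finset.Ico (0 : ℤ) (g * b : ℕ)).filter (fun i => i ≡ c [ZMOD b])).card : ℤ) = g := by
    rw [h]; simp
  exact_mod_cast this

/-- Pairs with a prescribed determinant, counted modulo the first period. -/
theorem exists_finset_pairs_det {N d d' q₁ r₁ : ℕ} (hN : 0 < N) (hd : 0 < d) (hd' : 0 < d')
    (hq : 0 < q₁) {a : ℤ} (ha0 : 0 ≤ a) (haN : a < N * d) (a' k : ℤ) :
    ∃ D : Finset (ℤ × ℤ), D.card = q₁.gcd r₁ ∧ ∀ x, x ∈ D ↔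
      (0 ≤ x.1 ∧ x.1 < N * (d * q₁) ∧ x.1 ≡ a [ZMOD (N * d)] ∧ x.2 ≡ a' [ZMOD (N * d')] ∧
        x.1 * (d' * r₁) - x.2 * (d * q₁) = (a * (d' * r₁) - a' * (d * q₁))
          + (N * d * d' * q₁.gcd r₁) * k) := by
  obtain ⟨g, q₂, r₂, hg, hcop, rfl, rfl⟩ := Nat.exists_coprime' (m := q₁) (n := r₁)
    (Nat.gcd_pos_of_pos_left _ hq)
  have hgg : (q₂ * g).gcd (r₂ * g) = g := by rw [Nat.gcd_mul_right, hcop.gcd_eq_one, one_mul]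
  rw [hgg]
  have hq₂ : 0 < q₂ := Nat.pos_of_mul_pos_right hq
  have hNz : (0 : ℤ) < N := by exact_mod_cast hN
  have hdz : (0 : ℤ) < d := by exact_mod_cast hd
  have hdz' : (0 : ℤ) < d' := by exact_mod_cast hd'
  have hgz : (0 : ℤ) < g := by exact_mod_cast hg
  have hqz : (0 : ℤ) < q₂ := by exact_mod_cast hq₂
  obtain ⟨s, t, hst⟩ : ∃ s t : ℤ, (r₂ : ℤ) * s + q₂ * t = 1 := by
    have := Int.isCoprime_iff_gcd_eq_one.2 (show Int.gcd (r₂ : ℤ) (q₂ : ℤ) = 1 by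
      simpa using hcop.symm)
    obtain ⟨s, t, h⟩ := this
    exact ⟨s, t, by linarith⟩
  -- With p = a + N d i and p' = a' + N d' j, the determinant equation reduces to r₂ i - q₂ j = k.
  -- It fixes i modulo q₂ and then determines j; the period leaves g q₂ values of i, hence g
  -- solutions.
  have key : ∀ i : ℤ, i ≡ k * s [ZMOD q₂] ↔ (q₂ : ℤ) ∣ r₂ * i - k := by
    intro i
    rw [Int.modEq_comm, Int.modEq_iff_dvd]
    constructor
    · rintro ⟨w, hw⟩
      exact ⟨r₂ * w - k * t, by linear_combination (r₂ : ℤ) * hw + k * hst⟩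
    · rintro ⟨w, hw⟩
      exact ⟨s * w + t * i, by linear_combination s * hw - i * hst⟩
  refine ⟨((Finset.Ico (0 : ℤ) (g * q₂ : ℕ)).filter (fun i => i ≡ k * s [ZMOD q₂])).image
    (fun i => (a + N * d * i, a' + N * d' * ((r₂ * i - k) / q₂))), ?_, ?_⟩
  · rw [Finset.card_image_of_injective, card_filter_modEq_mul hq₂]
    intro i j hij
    have h1 := (Prod.ext_iff.1 hij).1
    have : (N * d : ℤ) ≠ 0 := by positivity
    exact mul_left_cancel₀ this (by simpa using h1)
  · rintro ⟨p, p'⟩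
    simp only [Finset.mem_image, Finset.mem_filter, Finset.mem_Ico, Prod.mk.injEq, key]
    constructor
    · rintro ⟨i, ⟨⟨hi0, hi1⟩, w, hw⟩, rfl, rfl⟩
      rw [hw, Int.mul_ediv_cancel_left _ hqz.ne']
      push_cast at hi1 ⊢
      refine ⟨by positivity, ?_, ?_, ?_, ?_⟩
      · have : i + 1 ≤ g * q₂ := hi1
        nlinarith [mul_le_mul_of_nonneg_left this (by positivity : (0 : ℤ) ≤ N * d)]
      · exact (Int.modEq_iff_dvd.2 ⟨-i, by ring⟩)
      · exact (Int.modEq_iff_dvd.2 ⟨-w, by ring⟩)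
      · linear_combination ((N : ℤ) * d * d' * g) * hw
    · rintro ⟨h0, h1, h2, h3, h4⟩
      obtain ⟨i, hi⟩ := (Int.modEq_comm.trans Int.modEq_iff_dvd).1 h2
      obtain ⟨j, hj⟩ := (Int.modEq_comm.trans Int.modEq_iff_dvd).1 h3
      push_cast at h1 h4
      obtain rfl : p = a + N * d * i := by linarith
      obtain rfl : p' = a' + N * d' * j := by linarith
      have hNd : (0 : ℤ) < N * d := by positivity
      have hw : r₂ * i - k = q₂ * j := by
        have : ((N : ℤ) * d * d' * g) ≠ 0 := by positivity
        apply mul_left_cancel₀ this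
        linear_combination h4
      refine ⟨i, ⟨⟨?_, ?_⟩, j, hw⟩, rfl, ?_⟩
      · by_contra hneg
        have : i + 1 ≤ 0 := by omega
        nlinarith [mul_le_mul_of_nonneg_left this hNd.le]
      · push_cast
        by_contra hneg
        have : (g : ℤ) * q₂ ≤ i := by omega
        nlinarith [mul_le_mul_of_nonneg_left this hNd.le]
      · rw [hw, Int.mul_ediv_cancel_left _ hqz.ne']

/-- The determinants fill one residue class modulo N d d' g, g = gcd(q₁, r₁), and each value is
taken g times per period; this gives the main term with error O(g). They are also nonzero multiples
of d d' g, which gives the second bound without any additive error. -/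
theorem exists_finset_pairs {N d d' q₁ r₁ : ℕ} (hN : 0 < N) (hd : 0 < d) (hd' : 0 < d')
    (hq : 0 < q₁) {a a' : ℤ} (ha0 : 0 ≤ a) (haN : a < N * d)
    (hda : (d : ℤ) ∣ a) (hda' : (d' : ℤ) ∣ a') {u v : ℝ} (hu : u < 0) (hv : 0 < v) :
    ∃ D : Finset (ℤ × ℤ), (∀ x, x ∈ D ↔
      (0 ≤ x.1 ∧ x.1 < N * (d * q₁) ∧ x.1 ≡ a [ZMOD (N * d)] ∧ x.2 ≡ a' [ZMOD (N * d')] ∧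
        x.1 * (d' * r₁) - x.2 * (d * q₁) ≠ 0 ∧
        u < ((x.1 * (d' * r₁) - x.2 * (d * q₁) : ℤ) : ℝ) ∧
        ((x.1 * (d' * r₁) - x.2 * (d * q₁) : ℤ) : ℝ) < v)) ∧
      |(D.card : ℝ) - (v - u) / (N * d * d')| ≤ 2 * q₁.gcd r₁ ∧
      (D.card : ℝ) ≤ (v - u) / (d * d') := by
  set g := q₁.gcd r₁ with hg
  have hgpos : 0 < g := Nat.gcd_pos_of_pos_left _ hq
  choose F hFc hF using fun k => exists_finset_pairs_det (r₁ := r₁) hN hd hd' hq ha0 haN a' k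
  rw [← hg] at hFc hF
  set c : ℤ := a * (d' * r₁) - a' * (d * q₁) with hc
  set b : ℕ := d * d' * g with hb
  have hbpos : 0 < b := by positivity
  have hbR : (0 : ℝ) < b := by exact_mod_cast hbpos
  have hNR : (0 : ℝ) < N := by exact_mod_cast hN
  have hsR : (0 : ℝ) < N * b := by positivity
  obtain ⟨c₀, hc₀⟩ : (b : ℤ) ∣ c := by
    obtain ⟨w, hw⟩ := hda
    obtain ⟨w', hw'⟩ := hda'
    obtain ⟨x, hx⟩ := Nat.gcd_dvd_left q₁ r₁
    obtain ⟨y, hy⟩ := Nat.gcd_dvd_right q₁ r₁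
    rw [← hg] at hx hy
    refine ⟨w * y - w' * x, ?_⟩
    have hx' : (q₁ : ℤ) = g * x := by exact_mod_cast hx
    have hy' : (r₁ : ℤ) = g * y := by exact_mod_cast hy
    rw [hc, hw, hw', hx', hy', hb]; push_cast; ring
  set S := Finset.Ioo ⌊(u - c) / (N * b)⌋ ⌈(v - c) / (N * b)⌉ with hS
  have hmemS : ∀ k : ℤ, k ∈ S ↔ u < ((c + N * b * k : ℤ) : ℝ) ∧ ((c + N * b * k : ℤ) : ℝ) < v := by
    intro k
    rw [hS, mem_Ioo_floor_ceil, div_lt_iff₀ hsR, lt_div_iff₀ hsR]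
    push_cast
    constructor <;> rintro ⟨h1, h2⟩ <;> constructor <;> linarith
  set S' := S.filter (fun k => c + N * b * k ≠ 0) with hS'
  have hFc' : ∀ k, (F k).card = g := hFc
  have hdisj : (S' : Set ℤ).PairwiseDisjoint F := by
    intro k _ l _ hkl
    rw [Function.onFun, Finset.disjoint_left]
    intro x hx hx'
    have h1 := ((hF k x).1 hx).2.2.2.2
    have h2 := ((hF l x).1 hx').2.2.2.2
    apply hkl
    have : ((N : ℤ) * d * d' * g) ≠ 0 := by positivity
    exact mul_left_cancel₀ this (by linarith)
  have hcard : (S'.biUnion F).card = S'.card * g := by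
    rw [Finset.card_biUnion hdisj, Finset.sum_congr rfl (fun k _ => hFc' k)]; simp
  -- At most one k has determinant 0. Together with the rounding error of the interval this is the 2
  -- in the bound 2g.
  have hSle : (S.card : ℝ) ≤ S'.card + 1 := by
    have h1 : (S.filter (fun k => ¬ (c + N * b * k ≠ 0))).card ≤ 1 := by
      rw [Finset.card_le_one]
      intro k hk l hl
      simp only [ne_eq, not_not, Finset.mem_filter] at hk hl
      have : ((N : ℤ) * b) ≠ 0 := by positivity
      exact mul_left_cancel₀ this (by linarith [hk.2, hl.2])
    have h2 := Finset.card_filter_add_card_filter_not (s := S) (fun k => c + N * b * k ≠ 0)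
    rw [← hS'] at h2
    exact_mod_cast (by omega : S.card ≤ S'.card + 1)
  have hSle' : (S'.card : ℝ) ≤ S.card := by exact_mod_cast Finset.card_filter_le _ _
  have hSc : |(S.card : ℝ) - (v - u) / (N * b)| ≤ 1 := by
    have := abs_card_Ioo_floor_ceil_sub_le (α := (u - c) / (N * b)) (β := (v - c) / (N * b))
      (by gcongr; linarith)
    rwa [← hS, ← sub_div, sub_sub_sub_cancel_right] at this
  refine ⟨S'.biUnion F, ?_, ?_, ?_⟩
  · intro x
    simp only [Finset.mem_biUnion, hF]
    constructor
    · rintro ⟨k, hk, h0, h1, h2, h3, h4⟩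
      rw [hS', Finset.mem_filter, hmemS] at hk
      have e : x.1 * (d' * r₁) - x.2 * (d * q₁) = c + N * b * k := by
        rw [h4, hb]; push_cast; ring
      rw [e]
      exact ⟨h0, h1, h2, h3, hk.2, hk.1⟩
    · rintro ⟨h0, h1, h2, h3, h4, h5⟩
      obtain ⟨i, hi⟩ := (Int.modEq_comm.trans Int.modEq_iff_dvd).1 h2
      obtain ⟨j, hj⟩ := (Int.modEq_comm.trans Int.modEq_iff_dvd).1 h3
      obtain ⟨y, hy⟩ := Nat.gcd_dvd_left q₁ r₁
      obtain ⟨z, hz⟩ := Nat.gcd_dvd_right q₁ r₁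
      rw [← hg] at hy hz
      have hy' : (q₁ : ℤ) = g * y := by exact_mod_cast hy
      have hz' : (r₁ : ℤ) = g * z := by exact_mod_cast hz
      have e : x.1 * (d' * r₁) - x.2 * (d * q₁) = c + (N * d * d' * g) * (i * z - j * y) := by
        rw [hc, hy', hz']
        linear_combination (d' * (g * z) : ℤ) * hi - (d * (g * y) : ℤ) * hj
      refine ⟨i * z - j * y, ?_, h0, h1, h2, h3, e⟩
      have e' : x.1 * (d' * r₁) - x.2 * (d * q₁) = c + N * b * (i * z - j * y) := by
        rw [e, hb]; push_cast; ring
      rw [e'] at h4 h5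
      rw [hS', Finset.mem_filter, hmemS]
      exact ⟨h5, h4⟩
  · rw [hcard]
    have hgR : (0 : ℝ) < g := by exact_mod_cast hgpos
    have e : (v - u) / (N * d * d') = (v - u) / (N * b) * g := by
      have : (d : ℝ) ≠ 0 := by positivity
      have : (d' : ℝ) ≠ 0 := by positivity
      rw [hb]; push_cast; field_simp
    rw [e]; push_cast
    rw [← sub_mul, abs_mul, abs_of_pos hgR]
    refine mul_le_mul_of_nonneg_right ?_ hgR.le
    rw [abs_le] at hSc ⊢
    constructor <;> linarith
  · rw [hcard]
    have hgR : (0 : ℝ) < g := by exact_mod_cast hgpos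
    -- Divided by b, the determinants are distinct nonzero integers c₀ + N k in (u/b, v/b).
    have hle : S'.card ≤ ((Finset.Ioo ⌊u / b⌋ ⌈v / b⌉).erase 0).card := by
      refine Finset.card_le_card_of_injOn (fun k => c₀ + N * k) ?_ ?_
      · intro k hk
        rw [Finset.mem_coe, hS', Finset.mem_filter, hmemS] at hk
        have e : c + N * b * k = b * (c₀ + N * k) := by rw [hc₀]; ring
        rw [e] at hk
        rw [Finset.mem_coe, Finset.mem_erase, mem_Ioo_floor_ceil, div_lt_iff₀ hbR,
          lt_div_iff₀ hbR]
        refine ⟨fun h => hk.2 (by simp only [h, mul_zero]), ?_, ?_⟩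
        · have := hk.1.1; push_cast at this ⊢; linarith
        · have := hk.1.2; push_cast at this ⊢; linarith
      · intro k _ l _ hkl
        have : (N : ℤ) ≠ 0 := by positivity
        exact mul_left_cancel₀ this (by simpa using hkl)
    have h2 := card_erase_Ioo_floor_ceil_le (α := u / b) (β := v / b)
      (div_neg_of_neg_of_pos hu hbR) (by positivity)
    have h3 : (S'.card : ℝ) ≤ (v - u) / b := by
      rw [sub_div]; exact le_trans (by exact_mod_cast hle) h2
    have e : (v - u) / (d * d') = (v - u) / b * g := by
      have : (d : ℝ) ≠ 0 := by positivity
      have : (d' : ℝ) ≠ 0 := by positivity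
      rw [hb]; push_cast; field_simp
    rw [e]; push_cast
    exact mul_le_mul_of_nonneg_right h3 hgR.le

/-! ### Möbius inversion for primitive vectors in a residue class -/

/-- `∏_{p ∣ q, p ∤ N} (1 - 1/p)`, in its expanded form. -/
noncomputable def phiRatio (N q : ℕ) : ℝ :=
  ∑ d ∈ q.divisors.filter (fun d => d.Coprime N), (ArithmeticFunction.moebius d : ℝ) / d

theorem sum_divisors_moebius (n : ℕ) :
    ∑ d ∈ n.divisors, ArithmeticFunction.moebius d = if n = 1 then 1 else 0 := by
  rw [← ArithmeticFunction.coe_mul_zeta_apply, ArithmeticFunction.moebius_mul_coe_zeta,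
    ArithmeticFunction.one_apply]

/-- A common prime of gcd(p, q) and N would divide p₀, q₀ and N. This is why only divisors coprime
to N enter the Möbius sums. -/
theorem coprime_gcd_of_modEq {N : ℕ} {p₀ q₀ p q : ℤ} (hgcd : Nat.gcd (Int.gcd p₀ q₀) N = 1)
    (hp : p ≡ p₀ [ZMOD N]) (hq : q ≡ q₀ [ZMOD N]) : (Int.gcd p q).Coprime N := by
  by_contra h
  obtain ⟨l, hl, h1, h2⟩ := Nat.Prime.not_coprime_iff_dvd.1 h
  have hlN : (l : ℤ) ∣ N := by exact_mod_cast h2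
  have hlp : (l : ℤ) ∣ p := (Int.natCast_dvd_natCast.2 h1).trans (Int.gcd_dvd_left ..)
  have hlq : (l : ℤ) ∣ q := (Int.natCast_dvd_natCast.2 h1).trans (Int.gcd_dvd_right ..)
  have hlp₀ : (l : ℤ) ∣ p₀ := ((hp.of_dvd hlN).dvd_iff).1 hlp
  have hlq₀ : (l : ℤ) ∣ q₀ := ((hq.of_dvd hlN).dvd_iff).1 hlq
  have : l ∣ Nat.gcd (Int.gcd p₀ q₀) N := Nat.dvd_gcd (Int.dvd_gcd hlp₀ hlq₀) h2
  rw [hgcd] at this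
  exact hl.one_lt.ne' (Nat.dvd_one.1 this)

theorem sum_moebius_dvd_eq_ite {N q : ℕ} (hq : 0 < q) {p : ℤ} (h : (Int.gcd p q).Coprime N) :
    ∑ d ∈ q.divisors.filter (fun d => d.Coprime N),
      (if (d : ℤ) ∣ p then (ArithmeticFunction.moebius d : ℝ) else 0)
      = if Int.gcd p q = 1 then 1 else 0 := by
  rw [← Finset.sum_filter, Finset.filter_filter]
  have e : q.divisors.filter (fun d : ℕ => d.Coprime N ∧ (d : ℤ) ∣ p) = (Int.gcd p q).divisors := by
    ext d
    simp only [Finset.mem_filter, Nat.mem_divisors]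
    constructor
    · rintro ⟨⟨h1, h2⟩, h3, h4⟩
      exact ⟨Int.dvd_gcd h4 (by exact_mod_cast h1), by simp [Int.gcd_eq_zero_iff, hq.ne']⟩
    · rintro ⟨h1, h2⟩
      have h3 := Int.natCast_dvd_natCast.2 h1
      exact ⟨⟨by exact_mod_cast h3.trans (Int.gcd_dvd_right ..), hq.ne'⟩,
        Nat.Coprime.of_dvd_left h1 h, h3.trans (Int.gcd_dvd_left ..)⟩
  rw [e]
  have := sum_divisors_moebius (Int.gcd p q)
  exact_mod_cast this

/-- Chinese remainder theorem, with a representative that is itself a multiple of d. -/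
theorem exists_modEq_iff_of_coprime {N d : ℕ} (hN : 0 < N) (hd : 0 < d) (h : d.Coprime N) (p₀ : ℤ) :
    ∃ a : ℤ, 0 ≤ a ∧ a < N * d ∧ (d : ℤ) ∣ a ∧
      ∀ p : ℤ, p ≡ a [ZMOD (N * d)] ↔ (p ≡ p₀ [ZMOD N] ∧ (d : ℤ) ∣ p) := by
  obtain ⟨s, t, hst⟩ := Int.isCoprime_iff_gcd_eq_one.2 (show Int.gcd (N : ℤ) (d : ℤ) = 1 by
      simpa using h.symm)
  have hpos : (0 : ℤ) < N * d := by positivity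
  have hda : (d : ℤ) ∣ (p₀ * t * d) % (N * d) := by
    rw [Int.emod_def]
    exact dvd_sub (Dvd.intro_left _ rfl) ((Dvd.intro_left _ rfl).mul_right _)
  have ha : (p₀ * t * d) % (N * d) ≡ p₀ [ZMOD N] := by
    have h1 : (p₀ * t * d) % (N * d) ≡ p₀ * t * d [ZMOD N] := (Int.mod_modEq _ _).of_mul_right _
    refine h1.trans (Int.modEq_iff_dvd.2 ⟨p₀ * s, by linear_combination -p₀ * hst⟩)
  refine ⟨(p₀ * t * d) % (N * d), Int.emod_nonneg _ hpos.ne', Int.emod_lt_of_pos _ hpos, hda, ?_⟩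
  intro p
  rw [← Int.modEq_and_modEq_iff_modEq_mul (by simpa using h.symm)]
  refine and_congr ⟨fun h => h.trans ha, fun h => h.trans ha.symm⟩ ?_
  exact ⟨fun h => (h.dvd_iff).2 hda,
    fun h => ((Int.modEq_zero_iff_dvd.2 h).trans (Int.modEq_zero_iff_dvd.2 hda).symm)⟩

/-- The number of primitive residues modulo the period. -/
theorem card_filter_primitive {N q : ℕ} (hN : 0 < N) (hq : 0 < q) {p₀ q₀ : ℤ}
    (hgcd : Nat.gcd (Int.gcd p₀ q₀) N = 1) (hqq : (q : ℤ) ≡ q₀ [ZMOD N]) :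
    (((Finset.Ico (0 : ℤ) (N * q : ℕ)).filter
      (fun p => Int.gcd p q = 1 ∧ p ≡ p₀ [ZMOD N])).card : ℝ) = q * phiRatio N q := by
  set A := (Finset.Ico (0 : ℤ) (N * q : ℕ)).filter (fun p => p ≡ p₀ [ZMOD N]) with hA
  have h1 : (Finset.Ico (0 : ℤ) (N * q : ℕ)).filter (fun p => Int.gcd p q = 1 ∧ p ≡ p₀ [ZMOD N])
      = A.filter (fun p => Int.gcd p q = 1) := by
    rw [hA, Finset.filter_filter]; congr 1; ext p; simp [and_comm]
  rw [h1, Finset.card_filter]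
  push_cast
  have h2 : ∀ p ∈ A, (if Int.gcd p q = 1 then (1 : ℝ) else 0) =
      ∑ d ∈ q.divisors.filter (fun d => d.Coprime N),
      (if (d : ℤ) ∣ p then (ArithmeticFunction.moebius d : ℝ) else 0) := by
    intro p hp
    rw [sum_moebius_dvd_eq_ite hq (coprime_gcd_of_modEq hgcd (Finset.mem_filter.1 hp).2 hqq)]
  rw [Finset.sum_congr rfl h2, Finset.sum_comm, phiRatio, Finset.mul_sum]
  refine Finset.sum_congr rfl fun d hd => ?_
  obtain ⟨hd1, hd2⟩ := Finset.mem_filter.1 hd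
  have hdpos : 0 < d := Nat.pos_of_mem_divisors hd1
  obtain ⟨q₁, rfl⟩ := Nat.dvd_of_mem_divisors hd1
  obtain ⟨a, -, -, -, ha⟩ := exists_modEq_iff_of_coprime hN hdpos hd2 p₀
  rw [← Finset.sum_filter, Finset.sum_const, hA, Finset.filter_filter]
  have e : (Finset.Ico (0 : ℤ) (N * (d * q₁) : ℕ)).filter
      (fun p => p ≡ p₀ [ZMOD N] ∧ (d : ℤ) ∣ p)
      = (Finset.Ico (0 : ℤ) (q₁ * (N * d) : ℕ)).filter (fun p => p ≡ a [ZMOD (N * d : ℕ)]) := by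
    ext p
    simp only [Finset.mem_filter, ← ha]
    rw [show N * (d * q₁) = q₁ * (N * d) by ring]
    push_cast
    rfl
  rw [e, card_filter_modEq_mul (by positivity)]
  have : (d : ℝ) ≠ 0 := by positivity
  push_cast
  rw [nsmul_eq_mul]
  field_simp

/-- Both bounds are read off from the count: q · `phiRatio N q` is the size of a subset of a residue
class having q elements. -/
theorem phiRatio_nonneg_le_one {N q : ℕ} (hN : 0 < N) (hq : 0 < q) {p₀ q₀ : ℤ}
    (hgcd : Nat.gcd (Int.gcd p₀ q₀) N = 1) (hqq : (q : ℤ) ≡ q₀ [ZMOD N]) :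
    0 ≤ phiRatio N q ∧ phiRatio N q ≤ 1 := by
  have h := card_filter_primitive hN hq hgcd hqq
  have hqR : (0 : ℝ) < q := by exact_mod_cast hq
  constructor
  · by_contra! hneg
    have := mul_neg_of_pos_of_neg hqR hneg
    rw [← h] at this
    exact absurd this (not_lt.2 (Nat.cast_nonneg _))
  · have h1 : ((Finset.Ico (0 : ℤ) (N * q : ℕ)).filter
      (fun p => Int.gcd p q = 1 ∧ p ≡ p₀ [ZMOD N])).card ≤ q := by
      have h2 := card_filter_modEq_mul (g := q) hN p₀
      rw [mul_comm q N] at h2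
      calc _ ≤ ((Finset.Ico (0 : ℤ) (N * q : ℕ)).filter (fun i => i ≡ p₀ [ZMOD N])).card :=
            Finset.card_le_card (Finset.monotone_filter_right _ (fun p _ hp => hp.2))
        _ = q := h2
    have h3 : q * phiRatio N q ≤ q * 1 := by rw [← h, mul_one]; exact_mod_cast h1
    exact le_of_mul_le_mul_left h3 hqR

/-- Möbius inversion in each vector splits the count into terms indexed by (d, d'), each evaluated
by `exists_finset_pairs`. The error is kept as a minimum because neither bound suffices for all d,
d'. -/
theorem exists_finset_primitive_pairs {N q r : ℕ} (hN : 0 < N) (hq : 0 < q) (hr : 0 < r) {p₀ q₀ : ℤ}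
    (hgcd : Nat.gcd (Int.gcd p₀ q₀) N = 1) (hqq : (q : ℤ) ≡ q₀ [ZMOD N])
    (hrr : (r : ℤ) ≡ q₀ [ZMOD N]) {u v : ℝ} (hu : u < 0) (hv : 0 < v) :
    ∃ D : Finset (ℤ × ℤ), (∀ x, x ∈ D ↔
      (0 ≤ x.1 ∧ x.1 < N * q ∧ (Int.gcd x.1 q = 1 ∧ x.1 ≡ p₀ [ZMOD N]) ∧
        (Int.gcd x.2 r = 1 ∧ x.2 ≡ p₀ [ZMOD N]) ∧
        x.1 * r - x.2 * q ≠ 0 ∧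
        u < ((x.1 * r - x.2 * q : ℤ) : ℝ) ∧ ((x.1 * r - x.2 * q : ℤ) : ℝ) < v)) ∧
      (D.card : ℝ) ≤ (v - u) / N * (phiRatio N q * phiRatio N r) +
        ∑ d ∈ q.divisors, ∑ d' ∈ r.divisors, min (2 * (q.gcd r : ℝ)) ((v - u) / (d * d')) ∧
      (D.card : ℝ) ≤ v - u := by
  have hw : 0 < v - u := by linarith
  obtain ⟨D, hD, hD1, hD2⟩ := exists_finset_pairs (N := N) (d := 1) (d' := 1) (r₁ := r) hN one_pos
    one_pos hq (a := p₀ % N) (a' := p₀) (Int.emod_nonneg _ (by positivity))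
    (by simpa using Int.emod_lt_of_pos _ (by positivity)) (by simp) (by simp) hu hv
  have hD' : ∀ x, x ∈ D ↔ (0 ≤ x.1 ∧ x.1 < N * q ∧ x.1 ≡ p₀ [ZMOD N] ∧ x.2 ≡ p₀ [ZMOD N] ∧
        x.1 * r - x.2 * q ≠ 0 ∧
        u < ((x.1 * r - x.2 * q : ℤ) : ℝ) ∧ ((x.1 * r - x.2 * q : ℤ) : ℝ) < v) := by
    intro x
    rw [hD x]
    simp only [Nat.cast_one, one_mul, mul_one]
    have : x.1 ≡ p₀ % N [ZMOD N] ↔ x.1 ≡ p₀ [ZMOD N] :=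
      ⟨fun h => h.trans (Int.mod_modEq _ _), fun h => h.trans (Int.mod_modEq _ _).symm⟩
    rw [this]
  set A := q.divisors.filter (fun d => d.Coprime N) with hA
  set B := r.divisors.filter (fun d => d.Coprime N) with hB
  set P := D.filter (fun x => Int.gcd x.1 q = 1 ∧ Int.gcd x.2 r = 1) with hP
  have hPcard : (P.card : ℝ) ≤ v - u := by
    have h1 : (P.card : ℝ) ≤ D.card := by exact_mod_cast Finset.card_filter_le _ _
    have h2 : (D.card : ℝ) ≤ v - u := by simpa using hD2
    linarith
  refine ⟨P, ?_, ?_, hPcard⟩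
  · intro x
    rw [hP, Finset.mem_filter, hD']
    tauto
  have hsum : (P.card : ℝ) = ∑ d ∈ A, ∑ d' ∈ B, (ArithmeticFunction.moebius d : ℝ) *
      (ArithmeticFunction.moebius d' : ℝ) *
        ((D.filter (fun x => (d : ℤ) ∣ x.1 ∧ (d' : ℤ) ∣ x.2)).card : ℝ) := by
    rw [hP, Finset.card_filter]
    push_cast
    have h2 : ∀ x ∈ D, (if Int.gcd x.1 q = 1 ∧ Int.gcd x.2 r = 1 then (1 : ℝ) else 0) =
        ∑ d ∈ A, ∑ d' ∈ B, (ArithmeticFunction.moebius d : ℝ) *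
      (ArithmeticFunction.moebius d' : ℝ) * (if (d : ℤ) ∣ x.1 ∧ (d' : ℤ) ∣ x.2 then 1 else 0) := by
      intro x hx
      have hx' := (hD' x).1 hx
      have e1 := sum_moebius_dvd_eq_ite hq (coprime_gcd_of_modEq hgcd hx'.2.2.1 hqq)
      have e2 := sum_moebius_dvd_eq_ite hr (coprime_gcd_of_modEq hgcd hx'.2.2.2.1 hrr)
      have e3 : (if Int.gcd x.1 q = 1 ∧ Int.gcd x.2 r = 1 then (1 : ℝ) else 0) =
        (if Int.gcd x.1 q = 1 then 1 else 0) * (if Int.gcd x.2 r = 1 then 1 else 0) := by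
        by_cases h1 : Int.gcd x.1 q = 1 <;> by_cases h2 : Int.gcd x.2 r = 1 <;> simp [h1, h2]
      rw [e3, ← e1, ← e2, Finset.sum_mul_sum]
      refine Finset.sum_congr rfl fun d _ => Finset.sum_congr rfl fun d' _ => ?_
      by_cases h1 : (d : ℤ) ∣ x.1 <;> by_cases h2 : (d' : ℤ) ∣ x.2 <;> simp [h1, h2]
    rw [Finset.sum_congr rfl h2, Finset.sum_comm]
    refine Finset.sum_congr rfl fun d _ => ?_
    rw [Finset.sum_comm]
    refine Finset.sum_congr rfl fun d' _ => ?_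
    rw [← Finset.mul_sum, Finset.card_filter]
    push_cast
    rfl
  have hmain : (v - u) / N * (phiRatio N q * phiRatio N r) =
      ∑ d ∈ A, ∑ d' ∈ B, (ArithmeticFunction.moebius d : ℝ) *
      (ArithmeticFunction.moebius d' : ℝ) * ((v - u) / (N * d * d')) := by
    rw [phiRatio, phiRatio, Finset.sum_mul_sum, Finset.mul_sum]
    refine Finset.sum_congr rfl fun d _ => ?_
    rw [Finset.mul_sum]
    refine Finset.sum_congr rfl fun d' _ => ?_
    rw [div_mul_div_comm, div_mul_div_comm, mul_div_assoc']
    congr 1 <;> ring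
  have hbound : ∀ d ∈ A, ∀ d' ∈ B,
      |((D.filter (fun x => (d : ℤ) ∣ x.1 ∧ (d' : ℤ) ∣ x.2)).card : ℝ) - (v - u) / (N * d * d')|
        ≤ min (2 * (q.gcd r : ℝ)) ((v - u) / (d * d')) := by
    intro d hd d' hd'
    obtain ⟨hd1, hd2⟩ := Finset.mem_filter.1 hd
    obtain ⟨hd1', hd2'⟩ := Finset.mem_filter.1 hd'
    have hdpos : 0 < d := Nat.pos_of_mem_divisors hd1
    have hdpos' : 0 < d' := Nat.pos_of_mem_divisors hd1'
    obtain ⟨q₁, hq₁⟩ := Nat.dvd_of_mem_divisors hd1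
    obtain ⟨r₁, hr₁⟩ := Nat.dvd_of_mem_divisors hd1'
    have hq₁pos : 0 < q₁ := by
      rcases Nat.eq_zero_or_pos q₁ with h | h
      · subst h; omega
      · exact h
    obtain ⟨a, ha0, haN, hda, ha⟩ := exists_modEq_iff_of_coprime hN hdpos hd2 p₀
    obtain ⟨a', -, -, hda', ha'⟩ := exists_modEq_iff_of_coprime hN hdpos' hd2' p₀
    obtain ⟨E, hE, hE1, hE2⟩ := exists_finset_pairs (r₁ := r₁) hN hdpos hdpos' hq₁pos
      ha0 haN hda hda' hu hv
    have hEeq : D.filter (fun x => (d : ℤ) ∣ x.1 ∧ (d' : ℤ) ∣ x.2) = E := by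
      ext x
      rw [Finset.mem_filter, hD', hE, ha, ha']
      have c1 : (q : ℤ) = d * q₁ := by exact_mod_cast hq₁
      have c2 : (r : ℤ) = d' * r₁ := by exact_mod_cast hr₁
      rw [c1, c2]
      tauto
    rw [hEeq]
    have hgle : q₁.gcd r₁ ≤ q.gcd r :=
      Nat.le_of_dvd (Nat.gcd_pos_of_pos_left _ hq)
        (Nat.dvd_gcd ((Nat.gcd_dvd_left _ _).trans (hq₁ ▸ Nat.dvd_mul_left _ _))
          ((Nat.gcd_dvd_right _ _).trans (hr₁ ▸ Nat.dvd_mul_left _ _)))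
    have hgle' : (q₁.gcd r₁ : ℝ) ≤ q.gcd r := by exact_mod_cast hgle
    -- For the second bound, both the count and its main term lie in [0, (v - u)/(dd')].
    refine le_min (hE1.trans (by linarith)) ?_
    have hdR : (0 : ℝ) < d := by exact_mod_cast hdpos
    have hdR' : (0 : ℝ) < d' := by exact_mod_cast hdpos'
    have hN1 : (1 : ℝ) ≤ N := by exact_mod_cast hN
    have h3 : (v - u) / (N * d * d') ≤ (v - u) / (d * d') := by
      apply div_le_div_of_nonneg_left hw.le (by positivity)
      rw [mul_assoc]
      exact le_mul_of_one_le_left (by positivity) hN1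
    have h4 : 0 ≤ (v - u) / (N * d * d') := by positivity
    rw [abs_le]
    constructor <;> linarith [Nat.cast_nonneg (α := ℝ) E.card]
  rw [hsum, hmain, ← sub_le_iff_le_add', ← Finset.sum_sub_distrib]
  have hmu : ∀ d : ℕ, |(ArithmeticFunction.moebius d : ℝ)| ≤ 1 := fun d => by
    exact_mod_cast ArithmeticFunction.abs_moebius_le_one (n := d)
  have hnn : ∀ d d' : ℕ, 0 ≤ min (2 * (q.gcd r : ℝ)) ((v - u) / (d * d')) := fun d d' =>
    le_min (by positivity) (by positivity)
  calc _ ≤ ∑ d ∈ A, ∑ d' ∈ B, min (2 * (q.gcd r : ℝ)) ((v - u) / (d * d')) := by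
        refine Finset.sum_le_sum fun d hd => ?_
        rw [← Finset.sum_sub_distrib]
        refine Finset.sum_le_sum fun d' hd' => ?_
        rw [← mul_sub]
        refine (le_abs_self _).trans ?_
        rw [abs_mul, abs_mul]
        calc _ ≤ 1 * 1 * min (2 * (q.gcd r : ℝ)) ((v - u) / (d * d')) := by
              gcongr
              · exact hmu d
              · exact hmu d'
              · exact hbound d hd d' hd'
          _ = _ := by ring
    _ ≤ ∑ d ∈ q.divisors, ∑ d' ∈ r.divisors, min (2 * (q.gcd r : ℝ)) ((v - u) / (d * d')) := by
        refine (Finset.sum_le_sum fun d _ => Finset.sum_le_sum_of_subset_of_nonneg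
          (Finset.filter_subset _ _) fun d' _ _ => hnn d d').trans ?_
        exact Finset.sum_le_sum_of_subset_of_nonneg (Finset.filter_subset _ _)
          fun d _ _ => Finset.sum_nonneg fun d' _ => hnn d d'

/-! ### Unfolding integrals over a period -/

theorem lintegral_eq_tsum_setLIntegral_Ioc {T : ℝ} (hT : 0 < T) (H : ℝ → ENNReal) :
    ∫⁻ x, H x = ∑' k : ℤ, ∫⁻ x in Set.Ioc 0 T, H (x - k * T) := by
  rw [← setLIntegral_univ, ← iUnion_Ioc_add_zsmul hT 0, lintegral_iUnion
    (fun _ => measurableSet_Ioc) (Set.pairwise_disjoint_Ioc_add_zsmul 0 T),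
    ← (Equiv.neg ℤ).tsum_eq]
  refine tsum_congr fun k => ?_
  have h := (measurePreserving_add_right volume (-(k : ℝ) * T)).setLIntegral_comp_preimage_emb
    (measurableEmbedding_addRight (-(k : ℝ) * T)) H (Set.Ioc (0 + (Equiv.neg ℤ k) • T)
      (0 + ((Equiv.neg ℤ k) + 1) • T))
  rw [← h]
  have e : (fun x : ℝ => x + -(k : ℝ) * T) ⁻¹' (Set.Ioc (0 + (Equiv.neg ℤ k) • T)
      (0 + ((Equiv.neg ℤ k) + 1) • T)) = Set.Ioc 0 T := by
    ext x
    simp only [Equiv.neg_apply, zsmul_eq_mul, Set.mem_preimage, Set.mem_Ioc]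
    push_cast
    constructor <;> rintro ⟨h1, h2⟩ <;> constructor <;> linarith
  rw [e]
  refine lintegral_congr fun x => ?_
  congr 1; ring

/-- The number of integers `p` with property `P` and `|q x - p| < δ`. -/
noncomputable def hits (P : ℤ → Prop) [DecidablePred P] (q : ℕ) (δ x : ℝ) : ENNReal :=
  ∑' p : ℤ, if P p ∧ |q * x - p| < δ then 1 else 0

theorem measurable_hits (P : ℤ → Prop) [DecidablePred P] (q : ℕ) (δ : ℝ) :
    Measurable (hits P q δ) := by
  unfold hits
  refine Measurable.tsum fun p => ?_
  refine Measurable.ite ?_ measurable_const measurable_const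
  have : {x : ℝ | P p ∧ |q * x - p| < δ} = {x | P p} ∩ {x : ℝ | |q * x - p| < δ} := rfl
  rw [this]
  exact (MeasurableSet.const _).inter (measurableSet_lt (by fun_prop) measurable_const)

theorem hits_add_natCast {P : ℤ → Prop} [DecidablePred P] {N q : ℕ}
    (hP : ∀ p : ℤ, P (p + N * q) ↔ P p) (δ x : ℝ) :
    hits P q δ (x + N) = hits P q δ x := by
  unfold hits
  rw [← (Equiv.addRight ((N : ℤ) * q)).tsum_eq]
  refine tsum_congr fun p => ?_
  simp only [Equiv.coe_addRight, hP]
  congr 2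
  push_cast
  ring_nf

theorem hits_eq_encard {P : ℤ → Prop} [DecidablePred P] (q : ℕ) (δ x : ℝ) :
    hits P q δ x = {p : ℤ | P p ∧ |q * x - p| < δ}.encard := by
  rw [← ENNReal.tsum_set_one, tsum_subtype {p : ℤ | P p ∧ |q * x - p| < δ} (fun _ => (1 : ENNReal))]
  refine tsum_congr fun p => ?_
  simp [Set.indicator_apply]

theorem finite_hits {P : ℤ → Prop} (y δ : ℝ) : {p : ℤ | P p ∧ |y - p| < δ}.Finite := by
  refine (Set.finite_Icc ⌊y - δ⌋ ⌈y + δ⌉).subset ?_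
  rintro p ⟨-, hp⟩
  rw [abs_lt] at hp
  constructor
  · exact Int.floor_le_iff.2 (by linarith)
  · exact Int.le_ceil_iff.2 (by linarith)

/-- Unfolding: write p = k N q + j. Translating x by k N removes k from the condition and leaves h
unchanged, so the sum over k turns the period into the whole line. Recentring at j/q leaves the
single interval |q y| < δ. -/
theorem setLIntegral_hits_mul {P : ℤ → Prop} [DecidablePred P] {N q : ℕ} (hN : 0 < N) (hq : 0 < q)
    (hP : ∀ p k : ℤ, P (k * (N * q : ℕ) + p) ↔ P p) (δ : ℝ) {h : ℝ → ENNReal} (hm : Measurable h)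
    (hh : ∀ (x : ℝ) (k : ℤ), h (x - k * N) = h x) :
    ∫⁻ x in Set.Ioc 0 (N : ℝ), hits P q δ x * h x =
      ∫⁻ y in {y : ℝ | |q * y| < δ},
        ∑ p ∈ (Finset.Ico (0 : ℤ) (N * q : ℕ)).filter P, h (y + p / q) := by
  have hNR : (0 : ℝ) < N := by exact_mod_cast hN
  have hqR : (0 : ℝ) < q := by exact_mod_cast hq
  have : NeZero (N * q) := ⟨by positivity⟩
  set G : ℤ → ℝ → ENNReal := fun p x => (if P p ∧ |q * x - p| < δ then 1 else 0) * h x with hG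
  have hmeas : ∀ p : ℤ, MeasurableSet {x : ℝ | |q * x - p| < δ} := fun p =>
    measurableSet_lt (by fun_prop) measurable_const
  have hGm : ∀ p, Measurable (G p) := by
    intro p
    refine Measurable.mul (Measurable.ite ?_ measurable_const measurable_const) hm
    have : {x : ℝ | P p ∧ |q * x - p| < δ} = {x | P p} ∩ {x : ℝ | |q * x - p| < δ} := rfl
    rw [this]
    exact (MeasurableSet.const _).inter (hmeas p)
  have h1 : ∫⁻ x in Set.Ioc 0 (N : ℝ), hits P q δ x * h x =
      ∑' p : ℤ, ∫⁻ x in Set.Ioc 0 (N : ℝ), G p x := by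
    rw [← lintegral_tsum fun p => (hGm p).aemeasurable]
    refine lintegral_congr fun x => ?_
    rw [hG, ENNReal.tsum_mul_right, hits]
  have h2 : ∀ (k : ℤ) (j : Fin (N * q)) (x : ℝ), G (k * (N * q : ℕ) + j) x = G j (x - k * N) := by
    intro k j x
    simp only [hG, hP, hh]
    congr 3
    push_cast
    ring_nf
  have h3 : ∀ p : ℤ, ∫⁻ x, G p x = if P p then ∫⁻ y in {y : ℝ | |q * y| < δ}, h (y + p / q) else 0 := by
    intro p
    by_cases hp : P p
    · rw [if_pos hp, ← lintegral_add_right_eq_self _ ((p : ℝ) / q), ← lintegral_indicator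
        (by simpa using hmeas 0)]
      refine lintegral_congr fun y => ?_
      have : q * (y + p / q) - p = q * y := by field_simp; ring
      simp only [hG, this, hp, true_and, Set.indicator_apply, Set.mem_ofPred_eq]
      split_ifs <;> simp
    · rw [if_neg hp]
      simp [hG, hp]
  rw [h1, ← (Int.divModEquiv (N * q)).symm.tsum_eq,
    ENNReal.tsum_prod (f := fun k j => ∫⁻ x in Set.Ioc 0 (N : ℝ),
      G ((Int.divModEquiv (N * q)).symm (k, j)) x), ENNReal.tsum_comm, tsum_fintype]
  have h4 : ∀ j : Fin (N * q), ∑' k : ℤ, ∫⁻ x in Set.Ioc 0 (N : ℝ),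
      G ((Int.divModEquiv (N * q)).symm (k, j)) x =
      if P ((j : ℕ) : ℤ) then ∫⁻ y in {y : ℝ | |q * y| < δ}, h (y + (((j : ℕ) : ℤ) : ℝ) / q) else 0 := by
    intro j
    rw [← h3, lintegral_eq_tsum_setLIntegral_Ioc hNR]
    refine tsum_congr fun k => lintegral_congr fun x => ?_
    exact h2 k j x
  rw [Finset.sum_congr rfl fun j _ => h4 j, lintegral_finsetSum _ fun p _ => by fun_prop,
    Finset.sum_filter]
  rw [Fin.sum_univ_eq_sum_range (fun j : ℕ => if P (j : ℤ) then
    ∫⁻ y in {y : ℝ | |q * y| < δ}, h (y + ((j : ℤ) : ℝ) / q) else 0)]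
  refine Finset.sum_nbij' (fun j : ℕ => (j : ℤ)) Int.toNat ?_ ?_ ?_ ?_ ?_
  · intro j hj; simp at hj ⊢; exact_mod_cast hj
  · intro j hj; simp at hj ⊢; omega
  · intro j _; simp
  · intro j hj; simp at hj ⊢; omega
  · intro j _; rfl

theorem volume_abs_mul_lt {q : ℕ} (hq : 0 < q) {δ : ℝ} :
    volume {y : ℝ | |q * y| < δ} = ENNReal.ofReal (2 * δ / q) := by
  have hqR : (0 : ℝ) < q := by exact_mod_cast hq
  have : {y : ℝ | |q * y| < δ} = Set.Ioo (-(δ / q)) (δ / q) := by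
    ext y
    rw [Set.mem_ofPred_eq, abs_lt, Set.mem_Ioo, lt_div_iff₀ hqR, ← neg_div, div_lt_iff₀ hqR,
      mul_comm]
  rw [this, Real.volume_Ioo]
  congr 1; ring

/-- The numerators of the primitive vectors with second coordinate `q`. -/
abbrev PrimNum (N q : ℕ) (p₀ : ℤ) : ℤ → Prop := fun p => Int.gcd p q = 1 ∧ p ≡ p₀ [ZMOD N]

theorem primNum_mul_add {N q : ℕ} {p₀ : ℤ} (p k : ℤ) :
    PrimNum N q p₀ (k * (N * q : ℕ) + p) ↔ PrimNum N q p₀ p := by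
  have h1 : Int.gcd (k * (N * q : ℕ) + p) q = Int.gcd p q := by
    rw [show k * (N * q : ℕ) + p = p + (k * N) * q by push_cast; ring]
    simp
  have h2 : k * (N * q : ℕ) + p ≡ p [ZMOD N] :=
    Int.modEq_iff_dvd.2 ⟨-(k * q), by push_cast; ring⟩
  unfold PrimNum
  rw [h1]
  exact and_congr_right fun _ => ⟨fun h => h2.symm.trans h, fun h => h2.trans h⟩

theorem setLIntegral_hits {N q : ℕ} (hN : 0 < N) (hq : 0 < q) {p₀ q₀ : ℤ}
    (hgcd : Nat.gcd (Int.gcd p₀ q₀) N = 1) (hqq : (q : ℤ) ≡ q₀ [ZMOD N]) {δ : ℝ} (hδ : 0 < δ) :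
    ∫⁻ x in Set.Ioc 0 (N : ℝ), hits (PrimNum N q p₀) q δ x =
      ENNReal.ofReal (2 * δ * phiRatio N q) := by
  have h := setLIntegral_hits_mul hN hq (P := PrimNum N q p₀) primNum_mul_add δ
    (h := fun _ => 1) measurable_const (fun _ _ => rfl)
  simp only [mul_one] at h
  have hqR : (0 : ℝ) < q := by exact_mod_cast hq
  rw [h, Finset.sum_const, setLIntegral_const, volume_abs_mul_lt hq, nsmul_eq_mul, mul_one,
    ← ENNReal.ofReal_natCast, ← ENNReal.ofReal_mul (by positivity),
    card_filter_primitive hN hq hgcd hqq]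
  congr 1
  field_simp

theorem tsum_mem_finset_eq_card {ι : Type*} [DecidableEq ι] (D : Finset ι) :
    ∑' x : ι, (if x ∈ D then 1 else 0 : ENNReal) = D.card := by
  rw [tsum_eq_sum (s := D) (fun x hx => by simp [hx])]
  simp

/-- After unfolding, the integrand at y counts pairs (p, p') whose determinant lies within q ε of -q
r y, uniformly bounded by the pair count. The summand for q = r accounts for determinant 0. -/
theorem setLIntegral_hits_mul_hits_le {N q r : ℕ} (hN : 0 < N) (hr : 0 < r) (hrq : r ≤ q)
    {p₀ q₀ : ℤ} (hgcd : Nat.gcd (Int.gcd p₀ q₀) N = 1) (hqq : (q : ℤ) ≡ q₀ [ZMOD N])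
    (hrr : (r : ℤ) ≡ q₀ [ZMOD N]) {δ ε : ℝ} (hδ : 0 < δ) (hε : δ ≤ ε) :
    ∫⁻ x in Set.Ioc 0 (N : ℝ), hits (PrimNum N q p₀) q δ x * hits (PrimNum N r p₀) r ε x ≤
      ENNReal.ofReal (2 * δ / q * (min (2 * q * ε / N * (phiRatio N q * phiRatio N r) +
        ∑ d ∈ q.divisors, ∑ d' ∈ r.divisors, min (2 * (q.gcd r : ℝ)) (2 * q * ε / (d * d')))
          (2 * q * ε) + if q = r then (q : ℝ) else 0)) := by
  have hq : 0 < q := hr.trans_le hrq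
  have hqR : (0 : ℝ) < q := by exact_mod_cast hq
  have hrR : (0 : ℝ) < r := by exact_mod_cast hr
  have hrqR : (r : ℝ) ≤ q := by exact_mod_cast hrq
  have hεpos : 0 < ε := hδ.trans_le hε
  have hper : ∀ (x : ℝ) (k : ℤ), hits (PrimNum N r p₀) r ε (x - k * N)
      = hits (PrimNum N r p₀) r ε x := by
    have h1 : ∀ x : ℝ, Function.Periodic (hits (PrimNum N r p₀) r ε) (N : ℝ) := fun _ x =>
      hits_add_natCast (fun p => by
        rw [← primNum_mul_add (N := N) (q := r) (p₀ := p₀) p 1]; push_cast; ring_nf) ε x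
    intro x k
    exact (h1 0).sub_int_mul_eq k
  rw [setLIntegral_hits_mul hN hq (P := PrimNum N q p₀) primNum_mul_add δ
    (measurable_hits _ r ε) hper, mul_comm (2 * δ / q)]
  set M : ℝ := min (2 * q * ε / N * (phiRatio N q * phiRatio N r) +
        ∑ d ∈ q.divisors, ∑ d' ∈ r.divisors, min (2 * (q.gcd r : ℝ)) (2 * q * ε / (d * d')))
          (2 * q * ε) + if q = r then (q : ℝ) else 0 with hM
  set A := (Finset.Ico (0 : ℤ) (N * q : ℕ)).filter (PrimNum N q p₀) with hA
  have hAcard : (A.card : ℝ) ≤ q := by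
    rw [hA, card_filter_primitive hN hq hgcd hqq]
    exact mul_le_of_le_one_right hqR.le (phiRatio_nonneg_le_one hN hq hgcd hqq).2
  have key : ∀ y : ℝ, |q * y| < δ →
      ∑ p ∈ A, hits (PrimNum N r p₀) r ε (y + p / q) ≤ ENNReal.ofReal M := by
    intro y hy
    -- Here r ≤ q and δ ≤ ε are used; the inequality places 0 inside the determinant interval, as
    -- the pair count requires.
    have hy' : |r * y| < ε := by
      rw [abs_mul, abs_of_pos hrR]
      rw [abs_mul, abs_of_pos hqR] at hy
      exact ((mul_le_mul_of_nonneg_right hrqR (abs_nonneg y)).trans_lt hy).trans_le hε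
    rw [abs_lt] at hy'
    obtain ⟨D, hD, hD1, hD2⟩ := exists_finset_primitive_pairs hN hq hr hgcd hqq hrr
      (u := -(q * (r * y)) - q * ε) (v := -(q * (r * y)) + q * ε)
      (by nlinarith) (by nlinarith)
    rw [show -(q * (r * y)) + q * ε - (-(q * (r * y)) - q * ε) = 2 * q * ε by ring] at hD1 hD2
    set E : Finset (ℤ × ℤ) := if q = r then A.image (fun p => (p, p)) else ∅ with hE
    have hEc : (E.card : ℝ) ≤ if q = r then (q : ℝ) else 0 := by
      rw [hE]
      split_ifs
      · exact le_trans (by exact_mod_cast Finset.card_image_le) hAcard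
      · simp
    have hle : ∑ p ∈ A, hits (PrimNum N r p₀) r ε (y + p / q) ≤ (D.card : ENNReal) + E.card := by
      rw [← tsum_mem_finset_eq_card D, ← tsum_mem_finset_eq_card E, ← ENNReal.tsum_add]
      have e1 : ∑ p ∈ A, hits (PrimNum N r p₀) r ε (y + p / q) = ∑' x : ℤ × ℤ,
          if x.1 ∈ A then (if PrimNum N r p₀ x.2 ∧ |r * (y + x.1 / q) - x.2| < ε then 1 else 0)
          else 0 := by
        rw [ENNReal.tsum_prod (f := fun a b : ℤ => if a ∈ A then
          (if PrimNum N r p₀ b ∧ |r * (y + a / q) - b| < ε then 1 else 0) else 0),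
          tsum_eq_sum (s := A) (fun x hx => by simp [hx])]
        refine Finset.sum_congr rfl fun p hp => ?_
        simp only [hp, if_true, hits]
      rw [e1]
      refine ENNReal.tsum_le_tsum fun x => ?_
      by_cases hx1 : x.1 ∈ A
      swap
      · simp [hx1]
      rw [if_pos hx1]
      by_cases hx2 : PrimNum N r p₀ x.2 ∧ |r * (y + x.1 / q) - x.2| < ε
      swap
      · simp [hx2]
      rw [if_pos hx2]
      obtain ⟨hx2, hx3⟩ := hx2
      obtain ⟨hx0, hx1'⟩ := Finset.mem_filter.1 hx1
      rw [Finset.mem_Ico] at hx0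
      -- Determinant 0 means p/q = p'/r with both fractions reduced, hence q = r and p = p'.
      by_cases hdet : x.1 * r - x.2 * q = 0
      · have hxE : x ∈ E := by
          have hc1 : IsCoprime (x.1) (q : ℤ) := Int.isCoprime_iff_gcd_eq_one.2 hx1'.1
          have hc2 : IsCoprime (x.2) (r : ℤ) := Int.isCoprime_iff_gcd_eq_one.2 hx2.1
          have d1 : (q : ℤ) ∣ r := hc1.symm.dvd_of_dvd_mul_left ⟨x.2, by linarith⟩
          have d2 : (r : ℤ) ∣ q := hc2.symm.dvd_of_dvd_mul_left ⟨x.1, by linarith⟩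
          have hqr : q = r := Nat.dvd_antisymm (by exact_mod_cast d1) (by exact_mod_cast d2)
          rw [hE, if_pos hqr, Finset.mem_image]
          refine ⟨x.1, hx1, ?_⟩
          have hrz : (r : ℤ) ≠ 0 := by positivity
          ext
          · rfl
          · subst hqr
            exact mul_right_cancel₀ hrz (by linarith)
        simp [hxE]
      · have hxD : x ∈ D := by
          rw [hD]
          refine ⟨hx0.1, by exact_mod_cast hx0.2, hx1', hx2, hdet, ?_, ?_⟩ <;>
          · rw [abs_lt] at hx3
            have e2 : ((x.1 * r - x.2 * q : ℤ) : ℝ)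
              = q * (r * (y + x.1 / q) - x.2) - q * (r * y) := by
              push_cast; field_simp; ring
            rw [e2]
            have := mul_lt_mul_of_pos_left hx3.1 hqR
            have := mul_lt_mul_of_pos_left hx3.2 hqR
            linarith
        simp [hxD]
    refine hle.trans ?_
    rw [← Nat.cast_add, ← ENNReal.ofReal_natCast]
    apply ENNReal.ofReal_le_ofReal
    push_cast
    exact add_le_add (le_min hD1 hD2) hEc
  have hMnn : 0 ≤ M := by
    have h0 := phiRatio_nonneg_le_one hN hq hgcd hqq
    have h0' := phiRatio_nonneg_le_one hN hr hgcd hrr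
    have := h0.1
    have := h0'.1
    rw [hM]
    refine add_nonneg (le_min (add_nonneg (by positivity) ?_) (by positivity))
      (by split_ifs <;> positivity)
    exact Finset.sum_nonneg fun d _ => Finset.sum_nonneg fun d' _ =>
      le_min (by positivity) (by positivity)
  calc _ ≤ ∫⁻ y in {y : ℝ | |q * y| < δ}, ENNReal.ofReal M := by
        refine setLIntegral_mono measurable_const fun y hy => key y hy
    _ = _ := by
        rw [setLIntegral_const, volume_abs_mul_lt hq, ← ENNReal.ofReal_mul hMnn]

/-! ### Divisor sums against a non-increasing weight; total covariance -/

/-- Positivity and monotonicity of a sequence on the positive integers. -/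
structure PosAntitone (f : ℕ → ℝ) : Prop where
  pos : ∀ q, 0 < q → 0 < f q
  anti : ∀ q r, 0 < r → r ≤ q → f q ≤ f r

/-- By monotonicity, d copies of the value at a multiple of d are bounded by the sum over the d
integers ending there. -/
theorem PosAntitone.mul_sum_range_le {f : ℕ → ℝ} (hf : PosAntitone f) (d m : ℕ) :
    d * ∑ j ∈ Finset.range m, f (d * (j + 1)) ≤ ∑ i ∈ Finset.range (d * m), f (i + 1) := by
  induction m with
  | zero => simp
  | succ m ih =>
    rw [Finset.sum_range_succ, mul_add, Nat.mul_succ, Finset.sum_range_add]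
    refine add_le_add ih ?_
    calc (d : ℝ) * f (d * (m + 1)) = ∑ i ∈ Finset.range d, f (d * (m + 1)) := by simp
      _ ≤ _ := Finset.sum_le_sum fun i hi => hf.anti _ _ (by omega) (by
          rw [Finset.mem_range] at hi; rw [Nat.mul_succ]; omega)

theorem sum_Icc_one_eq_sum_range (f : ℕ → ℝ) (n : ℕ) :
    ∑ q ∈ Finset.Icc 1 n, f q = ∑ i ∈ Finset.range n, f (i + 1) := by
  rw [Finset.range_eq_Ico, Finset.sum_Ico_add' f 0 n 1]
  rfl

theorem PosAntitone.sum_nonneg {f : ℕ → ℝ} (hf : PosAntitone f) (n : ℕ) :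
    0 ≤ ∑ q ∈ Finset.Icc 1 n, f q :=
  Finset.sum_nonneg fun q hq => (hf.pos q (Finset.mem_Icc.1 hq).1).le

theorem filter_dvd_Icc_eq_image {d : ℕ} (hd : 0 < d) (n : ℕ) :
    (Finset.Icc 1 n).filter (fun q => d ∣ q) =
      (Finset.range (n / d)).image (fun j => d * (j + 1)) := by
  ext q
  simp only [Finset.mem_filter, Finset.mem_Icc, Finset.mem_image, Finset.mem_range]
  constructor
  · rintro ⟨⟨h1, h2⟩, w, rfl⟩
    have hw : 0 < w := Nat.pos_of_mul_pos_left h1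
    refine ⟨w - 1, ?_, by rw [Nat.sub_add_cancel hw]⟩
    have : w ≤ n / d := (Nat.le_div_iff_mul_le hd).2 (by linarith [mul_comm w d])
    omega
  · rintro ⟨j, hj, rfl⟩
    refine ⟨⟨Nat.mul_pos hd (Nat.succ_pos j), ?_⟩, Dvd.intro _ rfl⟩
    calc d * (j + 1) ≤ d * (n / d) := Nat.mul_le_mul_left _ hj
      _ ≤ n := Nat.mul_div_le n d

theorem PosAntitone.sum_filter_dvd_le {f : ℕ → ℝ} (hf : PosAntitone f) {d : ℕ} (hd : 0 < d) (n : ℕ) :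
    ∑ q ∈ (Finset.Icc 1 n).filter (fun q => d ∣ q), f q ≤ (∑ q ∈ Finset.Icc 1 n, f q) / d := by
  have hdR : (0 : ℝ) < d := by exact_mod_cast hd
  rw [filter_dvd_Icc_eq_image hd, Finset.sum_image (fun i _ j _ h => by
    have := Nat.eq_of_mul_eq_mul_left hd h; omega), le_div_iff₀ hdR, mul_comm,
    sum_Icc_one_eq_sum_range]
  refine (hf.mul_sum_range_le d _).trans ?_
  exact Finset.sum_le_sum_of_subset_of_nonneg
    (Finset.range_mono (Nat.mul_div_le n d)) (fun i _ _ => (hf.pos _ (Nat.succ_pos i)).le)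

/-- Exchange the sums: multiples of d carry at most 1/d of the mass of f, so the weight 1/d becomes
1/d², whose sum converges. -/
theorem PosAntitone.sum_mul_sum_divisors_le {f : ℕ → ℝ} (hf : PosAntitone f) (P : ℕ → Prop)
    [DecidablePred P] (n : ℕ) :
    ∑ q ∈ Finset.Icc 1 n, f q * ∑ d ∈ q.divisors.filter P, 1 / (d : ℝ) ≤
      (∑ q ∈ Finset.Icc 1 n, f q) * ∑ d ∈ (Finset.Icc 1 n).filter P, ((d : ℝ) ^ 2)⁻¹ := by
  have e : ∀ q ∈ Finset.Icc 1 n, f q * ∑ d ∈ q.divisors.filter P, 1 / (d : ℝ) =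
      ∑ d ∈ (Finset.Icc 1 n).filter P, if d ∣ q then f q * (1 / (d : ℝ)) else 0 := by
    intro q hq
    rw [Finset.mem_Icc] at hq
    rw [Finset.mul_sum, ← Finset.sum_filter]
    refine Finset.sum_congr ?_ fun _ _ => rfl
    ext d
    simp only [Finset.mem_filter, Nat.mem_divisors, Finset.mem_Icc]
    constructor
    · rintro ⟨⟨h1, h2⟩, h3⟩
      exact ⟨⟨⟨Nat.pos_of_dvd_of_pos h1 hq.1, (Nat.le_of_dvd hq.1 h1).trans hq.2⟩, h3⟩, h1⟩
    · rintro ⟨⟨-, h3⟩, h1⟩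
      exact ⟨⟨h1, by omega⟩, h3⟩
  rw [Finset.sum_congr rfl e, Finset.sum_comm, Finset.mul_sum]
  refine Finset.sum_le_sum fun d hd => ?_
  have hdpos : 0 < d := (Finset.mem_Icc.1 (Finset.mem_filter.1 hd).1).1
  have hdR : (0 : ℝ) < d := by exact_mod_cast hdpos
  rw [← Finset.sum_filter, ← Finset.sum_mul]
  calc _ ≤ (∑ q ∈ Finset.Icc 1 n, f q) / d * (1 / d) := by
        gcongr; exact hf.sum_filter_dvd_le hdpos n
    _ = _ := by field_simp

theorem sum_Icc_inv_sq_le_two (n : ℕ) : ∑ d ∈ Finset.Icc 1 n, ((d : ℝ) ^ 2)⁻¹ ≤ 2 := by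
  have h := sum_Ioo_inv_sq_le (α := ℝ) 0 (n + 1)
  have e : Finset.Ioo 0 (n + 1) = Finset.Icc 1 n := by ext; simp; omega
  rw [e] at h
  simpa using h

theorem sum_filter_lt_inv_sq_le {K : ℕ} (hK : 0 < K) (n : ℕ) :
    ∑ d ∈ (Finset.Icc 1 n).filter (fun d => K < d), ((d : ℝ) ^ 2)⁻¹ ≤ 1 / K := by
  have e : (Finset.Icc 1 n).filter (fun d => K < d) = Finset.Ioc K n := by ext; simp; omega
  rw [e]
  rcases le_total K n with h | h
  · refine (sum_Ioc_inv_sq_le_sub (α := ℝ) hK.ne' h).trans ?_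
    rw [one_div]
    exact sub_le_self _ (by positivity)
  · rw [Finset.Ioc_eq_empty (by omega), Finset.sum_empty]; positivity

/-- `∑_{d ∣ q} 1/d`. -/
noncomputable def invDivSum (q : ℕ) : ℝ := ∑ d ∈ q.divisors, 1 / (d : ℝ)

/-- `∑_{d ∣ q, d > K} 1/d`. -/
noncomputable def invDivTail (K q : ℕ) : ℝ :=
  ∑ d ∈ q.divisors.filter (fun d => K < d), 1 / (d : ℝ)

theorem invDivSum_nonneg (q : ℕ) : 0 ≤ invDivSum q := Finset.sum_nonneg fun _ _ => by positivity

theorem invDivTail_nonneg (K q : ℕ) : 0 ≤ invDivTail K q :=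
  Finset.sum_nonneg fun _ _ => by positivity

theorem PosAntitone.sum_mul_invDivSum_le {f : ℕ → ℝ} (hf : PosAntitone f) (n : ℕ) :
    ∑ q ∈ Finset.Icc 1 n, f q * invDivSum q ≤ 2 * ∑ q ∈ Finset.Icc 1 n, f q := by
  have h := hf.sum_mul_sum_divisors_le (fun _ => True) n
  simp only [Finset.filter_true] at h
  refine h.trans ?_
  rw [mul_comm]
  exact mul_le_mul_of_nonneg_right (sum_Icc_inv_sq_le_two n) (hf.sum_nonneg n)

theorem PosAntitone.sum_mul_invDivTail_le {f : ℕ → ℝ} (hf : PosAntitone f) {K : ℕ} (hK : 0 < K)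
    (n : ℕ) :
    ∑ q ∈ Finset.Icc 1 n, f q * invDivTail K q ≤ (∑ q ∈ Finset.Icc 1 n, f q) / K := by
  refine (hf.sum_mul_sum_divisors_le (fun d => K < d) n).trans ?_
  rw [div_eq_mul_one_div]
  exact mul_le_mul_of_nonneg_left (sum_filter_lt_inv_sq_le hK n) (hf.sum_nonneg n)

/-- Each common divisor e contributes the square of the mass of f on multiples of e, at most (Ψ/e)²;
the tail of ∑ 1/e² beyond K gives 1/K. -/
theorem PosAntitone.sum_sum_mul_card_le {f : ℕ → ℝ} (hf : PosAntitone f) {K : ℕ} (hK : 0 < K)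
    (n : ℕ) :
    ∑ q ∈ Finset.Icc 1 n, ∑ r ∈ Finset.Icc 1 n,
      f q * f r * (((q.gcd r).divisors.filter (fun e => K < e)).card : ℝ) ≤
      (∑ q ∈ Finset.Icc 1 n, f q) ^ 2 / K := by
  set S := (Finset.Icc 1 n).filter (fun d => K < d) with hS
  have e : ∀ q ∈ Finset.Icc 1 n, ∀ r ∈ Finset.Icc 1 n,
      f q * f r * (((q.gcd r).divisors.filter (fun e => K < e)).card : ℝ) =
      ∑ e ∈ S, (if e ∣ q then f q else 0) * (if e ∣ r then f r else 0) := by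
    intro q hq r hr
    rw [Finset.mem_Icc] at hq hr
    have h1 : ∀ e : ℕ, (if e ∣ q then f q else 0) * (if e ∣ r then f r else 0) =
        if e ∣ q ∧ e ∣ r then f q * f r else 0 := by
      intro e
      by_cases h1 : e ∣ q <;> by_cases h2 : e ∣ r <;> simp [h1, h2]
    rw [Finset.sum_congr rfl fun e _ => h1 e, ← Finset.sum_filter, Finset.sum_const,
      nsmul_eq_mul, mul_comm]
    congr 3
    ext d
    simp only [hS, Finset.mem_filter, Nat.mem_divisors, Finset.mem_Icc, Nat.dvd_gcd_iff]
    constructor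
    · rintro ⟨⟨⟨h1, h2⟩, -⟩, h3⟩
      exact ⟨⟨⟨Nat.pos_of_dvd_of_pos h1 hq.1, (Nat.le_of_dvd hq.1 h1).trans hq.2⟩, h3⟩, h1, h2⟩
    · rintro ⟨⟨-, h3⟩, h1, h2⟩
      exact ⟨⟨⟨h1, h2⟩, (Nat.gcd_pos_of_pos_left _ hq.1).ne'⟩, h3⟩
  rw [Finset.sum_congr rfl fun q hq => Finset.sum_congr rfl fun r hr => e q hq r hr]
  rw [Finset.sum_congr rfl fun q hq => Finset.sum_comm, Finset.sum_comm]
  set Ψ := ∑ q ∈ Finset.Icc 1 n, f q with hΨ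
  have hΨ0 : 0 ≤ Ψ := hf.sum_nonneg n
  calc _ ≤ ∑ d ∈ S, Ψ ^ 2 * ((d : ℝ) ^ 2)⁻¹ := by
        refine Finset.sum_le_sum fun d hd => ?_
        have hdpos : 0 < d := (Finset.mem_Icc.1 (Finset.mem_filter.1 hd).1).1
        have h1 := hf.sum_filter_dvd_le hdpos n
        have h0 : 0 ≤ ∑ q ∈ (Finset.Icc 1 n).filter (fun q => d ∣ q), f q :=
          Finset.sum_nonneg fun q hq =>
            (hf.pos q (Finset.mem_Icc.1 (Finset.mem_filter.1 hq).1).1).le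
        rw [← Finset.sum_mul_sum, ← Finset.sum_filter, ← pow_two]
        calc _ ≤ (Ψ / d) ^ 2 := pow_le_pow_left₀ h0 h1 2
          _ = _ := by rw [div_pow, div_eq_mul_inv]
    _ = Ψ ^ 2 * ∑ d ∈ S, ((d : ℝ) ^ 2)⁻¹ := by rw [Finset.mul_sum]
    _ ≤ Ψ ^ 2 * (1 / K) := by
        gcongr; exact sum_filter_lt_inv_sq_le hK n
    _ = _ := by ring

/-- The upper bound for the covariance of the counts at `q` and `r`. -/
noncomputable def covBound (f : ℕ → ℝ) (K q r : ℕ) : ℝ :=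
  4 * K ^ 3 * ((if r ≤ q then f q / q else 0) + (if q ≤ r then f r / r else 0)) +
  4 * (f q * f r * (invDivTail K q * invDivSum r + invDivSum q * invDivTail K r)) +
  4 * (f q * f r * (((q.gcd r).divisors.filter (fun e => K < e)).card : ℝ)) +
  if q = r then 2 * f q else 0

theorem covBound_comm (f : ℕ → ℝ) (K q r : ℕ) : covBound f K q r = covBound f K r q := by
  unfold covBound
  rw [Nat.gcd_comm]
  have h : (if q = r then 2 * f q else 0) = if r = q then 2 * f r else 0 := by
    by_cases h : q = r
    · subst h; rfl
    · rw [if_neg h, if_neg (Ne.symm h)]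
  rw [h]; ring

theorem PosAntitone.covBound_nonneg {f : ℕ → ℝ} (hf : PosAntitone f) (K : ℕ) {q r : ℕ} (hq : 0 < q)
    (hr : 0 < r) : 0 ≤ covBound f K q r := by
  have h1 := hf.pos q hq
  have h2 := hf.pos r hr
  have := invDivSum_nonneg q
  have := invDivSum_nonneg r
  have := invDivTail_nonneg K q
  have := invDivTail_nonneg K r
  unfold covBound
  have h3 : 0 ≤ (if r ≤ q then f q / q else 0) := by split_ifs <;> positivity
  have h4 : 0 ≤ (if q ≤ r then f r / r else 0) := by split_ifs <;> positivity
  have h5 : 0 ≤ (if q = r then 2 * f q else 0) := by split_ifs <;> positivity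
  positivity

/-- The first term of `covBound` sums to 8K³Ψ, since f(q)/q is summed over at most q values of r.
The divisor tails give 16Ψ²/K, the large gcds 4Ψ²/K, and the diagonal 2Ψ. -/
theorem PosAntitone.sum_sum_covBound_le {f : ℕ → ℝ} (hf : PosAntitone f) {K : ℕ} (hK : 0 < K)
    (n : ℕ) :
    ∑ q ∈ Finset.Icc 1 n, ∑ r ∈ Finset.Icc 1 n, covBound f K q r ≤
      8 * K ^ 3 * (∑ q ∈ Finset.Icc 1 n, f q) + 20 * (∑ q ∈ Finset.Icc 1 n, f q) ^ 2 / K +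
        2 * ∑ q ∈ Finset.Icc 1 n, f q := by
  set Ψ := ∑ q ∈ Finset.Icc 1 n, f q with hΨ
  have hΨ0 : 0 ≤ Ψ := hf.sum_nonneg n
  have h1 : ∑ q ∈ Finset.Icc 1 n, ∑ r ∈ Finset.Icc 1 n, (if r ≤ q then f q / q else 0) ≤ Ψ := by
    refine Finset.sum_le_sum fun q hq => ?_
    have hqpos := (Finset.mem_Icc.1 hq).1
    have hqR : (0 : ℝ) < q := by exact_mod_cast hqpos
    rw [← Finset.sum_filter, Finset.sum_const, nsmul_eq_mul]
    have hc : ((Finset.Icc 1 n).filter (fun r => r ≤ q)).card ≤ q := by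
      calc _ ≤ (Finset.Icc 1 q).card := Finset.card_le_card fun r hr => by
            simp only [Finset.mem_filter, Finset.mem_Icc] at hr ⊢; omega
        _ = q := by simp
    have hc' : (((Finset.Icc 1 n).filter (fun r => r ≤ q)).card : ℝ) ≤ q := by exact_mod_cast hc
    calc _ ≤ (q : ℝ) * (f q / q) :=
          mul_le_mul_of_nonneg_right hc' (div_nonneg (hf.pos q hqpos).le hqR.le)
      _ = f q := by field_simp
  have h2 : ∑ q ∈ Finset.Icc 1 n, ∑ r ∈ Finset.Icc 1 n, (if q ≤ r then f r / r else 0) ≤ Ψ := by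
    rw [Finset.sum_comm]; exact h1
  have hs := hf.sum_mul_invDivSum_le n
  have ht := hf.sum_mul_invDivTail_le hK n
  rw [← hΨ] at hs ht
  have hs0 : 0 ≤ ∑ q ∈ Finset.Icc 1 n, f q * invDivSum q := Finset.sum_nonneg fun q hq =>
    mul_nonneg (hf.pos q (Finset.mem_Icc.1 hq).1).le (invDivSum_nonneg q)
  have h3 : ∑ q ∈ Finset.Icc 1 n, ∑ r ∈ Finset.Icc 1 n,
      f q * f r * (invDivTail K q * invDivSum r + invDivSum q * invDivTail K r) ≤
      4 * (Ψ ^ 2 / K) := by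
    have e : ∑ q ∈ Finset.Icc 1 n, ∑ r ∈ Finset.Icc 1 n,
      f q * f r * (invDivTail K q * invDivSum r + invDivSum q * invDivTail K r) =
      2 * ((∑ q ∈ Finset.Icc 1 n, f q * invDivTail K q) *
        (∑ q ∈ Finset.Icc 1 n, f q * invDivSum q)) := by
      rw [two_mul]
      nth_rw 2 [mul_comm]
      rw [Finset.sum_mul_sum, Finset.sum_mul_sum, ← Finset.sum_add_distrib]
      refine Finset.sum_congr rfl fun q _ => ?_
      rw [← Finset.sum_add_distrib]
      exact Finset.sum_congr rfl fun r _ => by ring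
    rw [e]
    have := mul_le_mul ht hs hs0 (by positivity)
    calc _ ≤ 2 * (Ψ / K * (2 * Ψ)) := by linarith
      _ = _ := by ring
  have h4 := hf.sum_sum_mul_card_le hK n
  have h5 : ∑ q ∈ Finset.Icc 1 n, ∑ r ∈ Finset.Icc 1 n, (if q = r then 2 * f q else 0) = 2 * Ψ := by
    rw [hΨ, Finset.mul_sum]
    exact Finset.sum_congr rfl fun q hq => by rw [Finset.sum_ite_eq, if_pos hq]
  rw [← hΨ] at h4
  unfold covBound
  simp only [Finset.sum_add_distrib, ← Finset.mul_sum]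
  rw [h5]
  have hK3 : (0 : ℝ) ≤ 4 * K ^ 3 := by positivity
  have h12 := mul_le_mul_of_nonneg_left (add_le_add h1 h2) hK3
  have e20 : 20 * Ψ ^ 2 / K = 20 * (Ψ ^ 2 / K) := by ring
  rw [e20]
  linarith

/-- At most K² pairs have d, d' ≤ K, and each costs at most 2e ≤ 2K. For the others w/(dd') is used,
and one of the two divisors lies in the tail. -/
theorem sum_sum_min_le {K q r e : ℕ} (he : e ≤ K) {w : ℝ} (hw : 0 ≤ w) :
    ∑ d ∈ q.divisors, ∑ d' ∈ r.divisors, min (2 * (e : ℝ)) (w / (d * d')) ≤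
      2 * K ^ 3 + w * (invDivTail K q * invDivSum r + invDivSum q * invDivTail K r) := by
  have heR : (e : ℝ) ≤ K := by exact_mod_cast he
  have hcard : ∀ m : ℕ, ((m.divisors.filter (fun d => d ≤ K)).card : ℝ) ≤ K := by
    intro m
    have : (m.divisors.filter (fun d => d ≤ K)).card ≤ (Finset.Icc 1 K).card :=
      Finset.card_le_card fun d hd => by
        rw [Finset.mem_filter] at hd
        exact Finset.mem_Icc.2 ⟨Nat.pos_of_mem_divisors hd.1, hd.2⟩
    rw [Nat.card_Icc, Nat.add_sub_cancel] at this
    exact_mod_cast this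
  have hpt : ∀ d d' : ℕ, min (2 * (e : ℝ)) (w / (d * d')) ≤
      2 * K * ((if d ≤ K then 1 else 0) * (if d' ≤ K then 1 else 0)) +
      (w * ((if K < d then 1 / (d : ℝ) else 0) * (1 / (d' : ℝ))) +
        w * ((1 / (d : ℝ)) * (if K < d' then 1 / (d' : ℝ) else 0))) := by
    intro d d'
    have hw' : w / (d * d') = w * (1 / (d : ℝ) * (1 / (d' : ℝ))) := by
      rw [one_div_mul_one_div, mul_one_div]
    have hnn : 0 ≤ w * (1 / (d : ℝ) * (1 / (d' : ℝ))) := by positivity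
    rcases le_or_gt d K with h | h
    · rcases le_or_gt d' K with h' | h'
      · simp only [h, h', not_lt.2 h, not_lt.2 h', if_true, if_false]
        refine (min_le_left _ _).trans ?_
        linarith
      · simp only [not_le.2 h', h', if_true, if_false, not_lt.2 h]
        refine (min_le_right _ _).trans ?_
        rw [hw']; linarith
    · simp only [not_le.2 h, h, if_true, if_false]
      refine (min_le_right _ _).trans ?_
      have : 0 ≤ w * ((1 / (d : ℝ)) * (if K < d' then 1 / (d' : ℝ) else 0)) := by
        split_ifs <;> positivity
      rw [hw']; linarith
  refine (Finset.sum_le_sum fun d _ => Finset.sum_le_sum fun d' _ => hpt d d').trans ?_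
  simp only [Finset.sum_add_distrib, ← Finset.mul_sum, ← Finset.sum_mul]
  have e1 : ∀ m : ℕ, ∑ d ∈ m.divisors, (if d ≤ K then (1 : ℝ) else 0) =
      ((m.divisors.filter (fun d => d ≤ K)).card : ℝ) := fun m => by
    rw [← Finset.sum_filter]; simp
  have e2 : ∀ m : ℕ, ∑ d ∈ m.divisors, (if K < d then 1 / (d : ℝ) else 0) = invDivTail K m :=
    fun m => by rw [invDivTail, Finset.sum_filter]
  rw [e1, e1, e2, e2, ← invDivSum, ← invDivSum]
  have h1 : ((q.divisors.filter (fun d => d ≤ K)).card : ℝ) *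
      ((r.divisors.filter (fun d => d ≤ K)).card : ℝ) ≤ K * K :=
    mul_le_mul (hcard q) (hcard r) (Nat.cast_nonneg _) (Nat.cast_nonneg _)
  have h2 := mul_le_mul_of_nonneg_left h1 (by positivity : (0 : ℝ) ≤ 2 * K)
  linarith [show (2 : ℝ) * K * (K * K) = 2 * K ^ 3 by ring]

/-- If gcd(q, r) ≤ K, the Möbius error is split by divisor size. If gcd(q, r) > K, the trivial bound
4 f(q) f(r) is charged to the gcd itself, which is one of its own divisors exceeding K. -/
theorem PosAntitone.pair_bound_le {f : ℕ → ℝ} (hf : PosAntitone f) {K N q r : ℕ}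
    (hr : 0 < r) (hrq : r ≤ q) {a b : ℝ} (ha : 0 ≤ a) (hb : 0 ≤ b) :
    2 * f q / q * (min (2 * q * f r / N * (a * b) +
        ∑ d ∈ q.divisors, ∑ d' ∈ r.divisors, min (2 * (q.gcd r : ℝ)) (2 * q * f r / (d * d')))
          (2 * q * f r) + if q = r then (q : ℝ) else 0) ≤
      (2 * f q * a) * (2 * f r * b) / N + covBound f K q r := by
  have hq : 0 < q := hr.trans_le hrq
  have hqR : (0 : ℝ) < q := by exact_mod_cast hq
  have h1 := hf.pos q hq
  have h2 := hf.pos r hr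
  have := invDivSum_nonneg q
  have := invDivSum_nonneg r
  have := invDivTail_nonneg K q
  have := invDivTail_nonneg K r
  have hrr : 0 ≤ (if q ≤ r then f r / r else 0) := by split_ifs <;> positivity
  have hc : 0 < 2 * f q / q := by positivity
  rw [mul_add]
  have hdiag : 2 * f q / q * (if q = r then (q : ℝ) else 0) = if q = r then 2 * f q else 0 := by
    split_ifs
    · field_simp
    · simp
  rw [hdiag]
  unfold covBound
  rw [if_pos hrq]
  have hmain : 2 * f q / q * (2 * q * f r / N * (a * b)) = (2 * f q * a) * (2 * f r * b) / N := by
    field_simp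
  have hK0 : (0 : ℝ) ≤ 4 * K ^ 3 := by positivity
  have t1 : 0 ≤ 4 * (K : ℝ) ^ 3 * (if q ≤ r then f r / r else 0) := by positivity
  have t2 : 0 ≤ 4 * (f q * f r * (invDivTail K q * invDivSum r + invDivSum q * invDivTail K r)) := by
    positivity
  rcases le_or_gt (q.gcd r) K with he | he
  · have h3 := sum_sum_min_le (q := q) (r := r) he (show 0 ≤ 2 * q * f r by positivity)
    have h4 := mul_le_mul_of_nonneg_left ((min_le_left _ (2 * q * f r)).trans
      (add_le_add_right h3 (2 * q * f r / N * (a * b)))) hc.le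
    have t3 : 0 ≤ 4 * (f q * f r * (((q.gcd r).divisors.filter (fun e => K < e)).card : ℝ)) := by
      positivity
    have e : 2 * f q / q * (2 * q * f r / N * (a * b) + (2 * K ^ 3 + 2 * q * f r *
        (invDivTail K q * invDivSum r + invDivSum q * invDivTail K r))) =
        (2 * f q * a) * (2 * f r * b) / N + (4 * K ^ 3 * (f q / q) +
        4 * (f q * f r * (invDivTail K q * invDivSum r + invDivSum q * invDivTail K r))) := by
      rw [mul_add, hmain]; field_simp; ring
    rw [e] at h4
    linarith
  · have h4 := mul_le_mul_of_nonneg_left (min_le_right (2 * q * f r / N * (a * b) +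
        ∑ d ∈ q.divisors, ∑ d' ∈ r.divisors, min (2 * (q.gcd r : ℝ)) (2 * q * f r / (d * d')))
          (2 * q * f r)) hc.le
    have e : 2 * f q / q * (2 * q * f r) = 4 * (f q * f r * 1) := by field_simp; ring
    have h5 : (1 : ℝ) ≤ (((q.gcd r).divisors.filter (fun e => K < e)).card : ℝ) := by
      have : 0 < ((q.gcd r).divisors.filter (fun e => K < e)).card :=
        Finset.card_pos.2 ⟨q.gcd r, Finset.mem_filter.2
          ⟨Nat.mem_divisors_self _ (Nat.gcd_pos_of_pos_left _ hq).ne', he⟩⟩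
      exact_mod_cast this
    have h6 : f q * f r * 1 ≤
        f q * f r * (((q.gcd r).divisors.filter (fun e => K < e)).card : ℝ) :=
      mul_le_mul_of_nonneg_left h5 (by positivity)
    have t4 : 0 ≤ (2 * f q * a) * (2 * f r * b) / N := by positivity
    have t5 : 0 ≤ 4 * (K : ℝ) ^ 3 * (f q / q) := by positivity
    rw [e] at h4
    linarith

/-! ### First and second moments of the counts -/

/-- The number of primitive `(p, q) ≡ (p₀, q₀) (mod N)` with the given `q` and `|q x - p| < f q`. -/
noncomputable def approxCount (f : ℕ → ℝ) (N : ℕ) (p₀ q₀ : ℤ) (q : ℕ) (x : ℝ) : ℝ :=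
  if (q : ℤ) ≡ q₀ [ZMOD N] then (hits (PrimNum N q p₀) q (f q) x).toReal else 0

/-- The integral of `approxCount` over a period. -/
noncomputable def meanCount (f : ℕ → ℝ) (N : ℕ) (q₀ : ℤ) (q : ℕ) : ℝ :=
  if (q : ℤ) ≡ q₀ [ZMOD N] then 2 * f q * phiRatio N q else 0

theorem approxCount_nonneg (f : ℕ → ℝ) (N : ℕ) (p₀ q₀ : ℤ) (q : ℕ) (x : ℝ) :
    0 ≤ approxCount f N p₀ q₀ q x := by
  unfold approxCount; split_ifs <;> positivity

theorem measurable_approxCount (f : ℕ → ℝ) (N : ℕ) (p₀ q₀ : ℤ) (q : ℕ) :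
    Measurable (approxCount f N p₀ q₀ q) := by
  unfold approxCount
  split_ifs
  · exact (measurable_hits _ _ _).ennreal_toReal
  · exact measurable_const

theorem approxCount_add_natCast (f : ℕ → ℝ) (N : ℕ) (p₀ q₀ : ℤ) (q : ℕ) (x : ℝ) :
    approxCount f N p₀ q₀ q (x + N) = approxCount f N p₀ q₀ q x := by
  unfold approxCount
  rw [hits_add_natCast fun p => ?_]
  rw [← primNum_mul_add (N := N) (q := q) (p₀ := p₀) p 1]; push_cast; ring_nf

section

variable {f : ℕ → ℝ} {N : ℕ} {p₀ q₀ : ℤ}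

theorem integrable_of_setLIntegral_le {s : Set ℝ} {g : ℝ → ENNReal} (hg : Measurable g) {C : ℝ}
    (hC : 0 ≤ C) (h : ∫⁻ x in s, g x ≤ ENNReal.ofReal C) :
    IntegrableOn (fun x => (g x).toReal) s ∧ ∫ x in s, (g x).toReal ≤ C := by
  have hne : ∫⁻ x in s, g x ≠ ⊤ := ne_top_of_le_ne_top ENNReal.ofReal_ne_top h
  refine ⟨integrable_toReal_of_lintegral_ne_top hg.aemeasurable hne, ?_⟩
  rw [integral_toReal hg.aemeasurable (ae_lt_top hg hne)]
  exact ENNReal.toReal_le_of_le_ofReal hC h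

theorem PosAntitone.integral_approxCount (hf : PosAntitone f) (hN : 0 < N)
    (hgcd : Nat.gcd (Int.gcd p₀ q₀) N = 1) {q : ℕ} (hq : 0 < q) :
    IntegrableOn (approxCount f N p₀ q₀ q) (Set.Ioc 0 (N : ℝ)) ∧
      ∫ x in Set.Ioc 0 (N : ℝ), approxCount f N p₀ q₀ q x = meanCount f N q₀ q := by
  unfold approxCount meanCount
  by_cases hqq : (q : ℤ) ≡ q₀ [ZMOD N]
  · simp only [if_pos hqq]
    have h := setLIntegral_hits hN hq hgcd hqq (hf.pos q hq)
    have hm := measurable_hits (PrimNum N q p₀) q (f q)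
    have hnn : 0 ≤ 2 * f q * phiRatio N q := by
      have := hf.pos q hq
      have := (phiRatio_nonneg_le_one hN hq hgcd hqq).1
      positivity
    refine ⟨(integrable_of_setLIntegral_le hm hnn h.le).1, ?_⟩
    rw [integral_toReal hm.aemeasurable (ae_lt_top hm (h ▸ ENNReal.ofReal_ne_top)), h,
      ENNReal.toReal_ofReal hnn]
  · simp [hqq]

theorem PosAntitone.integral_approxCount_mul_le_of_le (hf : PosAntitone f) (hN : 0 < N)
    (hgcd : Nat.gcd (Int.gcd p₀ q₀) N = 1) (K : ℕ) {q r : ℕ} (hr : 0 < r) (hrq : r ≤ q) :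
    IntegrableOn (fun x => approxCount f N p₀ q₀ q x * approxCount f N p₀ q₀ r x)
      (Set.Ioc 0 (N : ℝ)) ∧
      ∫ x in Set.Ioc 0 (N : ℝ), approxCount f N p₀ q₀ q x * approxCount f N p₀ q₀ r x ≤
        meanCount f N q₀ q * meanCount f N q₀ r / N + covBound f K q r := by
  have hq : 0 < q := hr.trans_le hrq
  have hcov := hf.covBound_nonneg K hq hr
  unfold approxCount meanCount
  by_cases hqq : (q : ℤ) ≡ q₀ [ZMOD N]
  swap
  · simp [hqq, hcov]
  by_cases hrr : (r : ℤ) ≡ q₀ [ZMOD N]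
  swap
  · simp [hrr, hcov]
  simp only [if_pos hqq, if_pos hrr, ← ENNReal.toReal_mul]
  have a0 := (phiRatio_nonneg_le_one hN hq hgcd hqq).1
  have b0 := (phiRatio_nonneg_le_one hN hr hgcd hrr).1
  have hfq := hf.pos q hq
  have hfr := hf.pos r hr
  refine integrable_of_setLIntegral_le ((measurable_hits _ _ _).mul (measurable_hits _ _ _))
    (by positivity) ?_
  refine (setLIntegral_hits_mul_hits_le hN hr hrq hgcd hqq hrr hfq (hf.anti q r hr hrq)).trans ?_
  exact ENNReal.ofReal_le_ofReal (hf.pair_bound_le hr hrq a0 b0)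

theorem PosAntitone.integral_approxCount_mul_le (hf : PosAntitone f) (hN : 0 < N)
    (hgcd : Nat.gcd (Int.gcd p₀ q₀) N = 1) (K : ℕ) {q r : ℕ} (hq : 0 < q) (hr : 0 < r) :
    IntegrableOn (fun x => approxCount f N p₀ q₀ q x * approxCount f N p₀ q₀ r x)
      (Set.Ioc 0 (N : ℝ)) ∧
      ∫ x in Set.Ioc 0 (N : ℝ), approxCount f N p₀ q₀ q x * approxCount f N p₀ q₀ r x ≤
        meanCount f N q₀ q * meanCount f N q₀ r / N + covBound f K q r := by
  rcases le_total r q with h | h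
  · exact hf.integral_approxCount_mul_le_of_le hN hgcd K hr h
  · have := hf.integral_approxCount_mul_le_of_le hN hgcd K hq h
    rw [covBound_comm, mul_comm (meanCount f N q₀ q)]
    simpa only [mul_comm] using this

/-- The second moment estimate. -/
theorem PosAntitone.integral_sq_sub_le (hf : PosAntitone f) (hN : 0 < N)
    (hgcd : Nat.gcd (Int.gcd p₀ q₀) N = 1) {K : ℕ} (hK : 0 < K) (n : ℕ) :
    IntegrableOn (fun x => (∑ q ∈ Finset.Icc 1 n, approxCount f N p₀ q₀ q x -
        (∑ q ∈ Finset.Icc 1 n, meanCount f N q₀ q) / N) ^ 2) (Set.Ioc 0 (N : ℝ)) ∧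
    ∫ x in Set.Ioc 0 (N : ℝ), (∑ q ∈ Finset.Icc 1 n, approxCount f N p₀ q₀ q x -
        (∑ q ∈ Finset.Icc 1 n, meanCount f N q₀ q) / N) ^ 2 ≤
      8 * K ^ 3 * (∑ q ∈ Finset.Icc 1 n, f q) + 20 * (∑ q ∈ Finset.Icc 1 n, f q) ^ 2 / K +
        2 * ∑ q ∈ Finset.Icc 1 n, f q := by
  set c := approxCount f N p₀ q₀ with hc
  set M := meanCount f N q₀ with hM
  set s := Set.Ioc 0 (N : ℝ) with hs
  set A := ∑ q ∈ Finset.Icc 1 n, M q with hA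
  have hNR : (0 : ℝ) < N := by exact_mod_cast hN
  have h1 : ∀ q ∈ Finset.Icc 1 n, IntegrableOn (c q) s ∧ ∫ x in s, c q x = M q := fun q hq =>
    hf.integral_approxCount hN hgcd (Finset.mem_Icc.1 hq).1
  have h2 : ∀ q ∈ Finset.Icc 1 n, ∀ r ∈ Finset.Icc 1 n, IntegrableOn (fun x => c q x * c r x) s ∧
      ∫ x in s, c q x * c r x ≤ M q * M r / N + covBound f K q r := fun q hq r hr =>
    hf.integral_approxCount_mul_le hN hgcd K (Finset.mem_Icc.1 hq).1 (Finset.mem_Icc.1 hr).1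
  -- Since the count has integral A over a period of length N, expanding the square leaves ∫ S² -
  -- A²/N; the main terms of the covariances sum to A²/N and cancel.
  have e : ∀ x, (∑ q ∈ Finset.Icc 1 n, c q x - A / N) ^ 2 =
      (∑ q ∈ Finset.Icc 1 n, ∑ r ∈ Finset.Icc 1 n, c q x * c r x -
        2 * (A / N) * ∑ q ∈ Finset.Icc 1 n, c q x) + (A / N) ^ 2 := by
    intro x
    rw [← Finset.sum_mul_sum]; ring
  have i1 : Integrable (fun x => ∑ q ∈ Finset.Icc 1 n, c q x) (volume.restrict s) :=
    integrable_finsetSum _ fun q hq => (h1 q hq).1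
  have i2 : Integrable (fun x => ∑ q ∈ Finset.Icc 1 n, ∑ r ∈ Finset.Icc 1 n, c q x * c r x)
      (volume.restrict s) :=
    integrable_finsetSum _ fun q hq => integrable_finsetSum _ fun r hr => (h2 q hq r hr).1
  have i3 : Integrable (fun _ : ℝ => (A / N) ^ 2) (volume.restrict s) := integrable_const _
  have i12 := i2.sub (i1.const_mul (2 * (A / N)))
  simp only [e]
  refine ⟨i12.add i3, ?_⟩
  have E1 := integral_add i12 i3
  have E2 := integral_sub i2 (i1.const_mul (2 * (A / N)))
  simp only [Pi.sub_apply] at E1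
  rw [E1, E2, integral_const_mul, integral_finsetSum _ fun q hq => (h1 q hq).1,
    integral_finsetSum _ fun q hq => integrable_finsetSum _ fun r hr => (h2 q hq r hr).1,
    Finset.sum_congr rfl fun q hq => (h1 q hq).2, ← hA]
  have h3 : ∑ q ∈ Finset.Icc 1 n, ∫ x in s, ∑ r ∈ Finset.Icc 1 n, c q x * c r x ≤
      A ^ 2 / N + ∑ q ∈ Finset.Icc 1 n, ∑ r ∈ Finset.Icc 1 n, covBound f K q r := by
    have e3 : A ^ 2 / N = ∑ q ∈ Finset.Icc 1 n, ∑ r ∈ Finset.Icc 1 n, M q * M r / N := by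
      rw [pow_two, hA, Finset.sum_mul_sum, Finset.sum_div]
      exact Finset.sum_congr rfl fun q _ => Finset.sum_div _ _ _
    rw [e3, ← Finset.sum_add_distrib]
    refine Finset.sum_le_sum fun q hq => ?_
    rw [integral_finsetSum _ fun r hr => (h2 q hq r hr).1, ← Finset.sum_add_distrib]
    exact Finset.sum_le_sum fun r hr => (h2 q hq r hr).2
  have h4 := hf.sum_sum_covBound_le hK n
  have e4 : ∫ x in s, (A / N) ^ 2 = A ^ 2 / N := by
    rw [integral_const, hs]
    simp only [MeasurableSet.univ, measureReal_restrict_apply, Set.univ_inter, Real.volume_real_Ioc,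
      sub_zero, smul_eq_mul, max_eq_left hNR.le]
    field_simp
  have e5 : 2 * (A / N) * A = 2 * (A ^ 2 / N) := by ring
  rw [e4, e5]
  linarith

end

/-! ### The Euler product and the average of `phiRatio` -/

/-- The completely multiplicative function `d ↦ [gcd(d, N) = 1] d⁻²`. -/
noncomputable def coprimeInvSq (N : ℕ) : ℕ →*₀ ℝ where
  toFun d := if d.Coprime N then 1 / (d : ℝ) ^ 2 else 0
  map_zero' := by simp
  map_one' := by simp
  map_mul' m n := by
    by_cases h1 : m.Coprime N
    · by_cases h2 : n.Coprime N
      · rw [if_pos h1, if_pos h2, if_pos (h1.mul_left h2)]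
        push_cast
        rw [mul_pow, one_div_mul_one_div]
      · rw [if_neg h2, if_neg fun h => h2 (Nat.coprime_mul_iff_left.1 h).2, mul_zero]
    · rw [if_neg h1, if_neg fun h => h1 (Nat.coprime_mul_iff_left.1 h).1, zero_mul]

theorem coprimeInvSq_apply (N d : ℕ) :
    coprimeInvSq N d = if d.Coprime N then 1 / (d : ℝ) ^ 2 else 0 := rfl

theorem coprimeInvSq_nonneg (N d : ℕ) : 0 ≤ coprimeInvSq N d := by
  rw [coprimeInvSq_apply]; split_ifs <;> positivity

theorem coprimeInvSq_le (N d : ℕ) : coprimeInvSq N d ≤ 1 / (d : ℝ) ^ 2 := by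
  rw [coprimeInvSq_apply]; split_ifs
  · exact le_rfl
  · positivity

theorem summable_one_div_sq : Summable fun d : ℕ => 1 / (d : ℝ) ^ 2 :=
  Real.summable_one_div_nat_pow.2 one_lt_two

theorem summable_coprimeInvSq (N : ℕ) : Summable (coprimeInvSq N) :=
  Summable.of_nonneg_of_le (coprimeInvSq_nonneg N) (coprimeInvSq_le N) summable_one_div_sq

theorem hasProd_coprimeInvSq (N : ℕ) :
    HasProd (fun p : Nat.Primes => (1 - coprimeInvSq N p)⁻¹) (∑' n, coprimeInvSq N n) :=
  EulerProduct.eulerProduct_completely_multiplicative_hasProd (summable_coprimeInvSq N).norm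

/-- In the Euler product over all primes, those dividing N contribute the factor 1. -/
theorem zetaN_two_eq_tsum (N : ℕ) : zetaN N 2 = ∑' n, coprimeInvSq N n := by
  rw [← (hasProd_coprimeInvSq N).tprod_eq, zetaN]
  have hinj : Function.Injective (fun p : {p : ℕ // p.Prime ∧ ¬ p ∣ N} =>
      (⟨p.1, p.2.1⟩ : Nat.Primes)) := by
    intro p q h
    exact Subtype.ext (congrArg (fun x : Nat.Primes => (x : ℕ)) h)
  have hsupp : Function.mulSupport (fun p : Nat.Primes => (1 - coprimeInvSq N p)⁻¹) ⊆
      Set.range fun p : {p : ℕ // p.Prime ∧ ¬ p ∣ N} => (⟨p.1, p.2.1⟩ : Nat.Primes) := by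
    intro p hp
    by_contra hr
    apply hp
    have : (p : ℕ) ∣ N := by
      by_contra hd
      exact hr ⟨⟨p.1, p.2, hd⟩, rfl⟩
    have e : coprimeInvSq N (p : ℕ) = 0 := by
      rw [coprimeInvSq_apply, if_neg (fun h => p.2.coprime_iff_not_dvd.1 h this)]
    simp [e]
  refine Eq.trans ?_ (hinj.tprod_eq hsupp)
  refine tprod_congr fun p => ?_
  rw [coprimeInvSq_apply, if_pos (p.2.1.coprime_iff_not_dvd.2 p.2.2)]

theorem zetaN_two_pos (N : ℕ) : 0 < zetaN N 2 := by
  rw [zetaN_two_eq_tsum]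
  have h := (summable_coprimeInvSq N).le_tsum 1 (fun d _ => coprimeInvSq_nonneg N d)
  have h1 : coprimeInvSq N 1 = 1 := (coprimeInvSq N).map_one
  linarith

theorem abs_moebius_cast_le_one (d : ℕ) : |(ArithmeticFunction.moebius d : ℝ)| ≤ 1 := by
  exact_mod_cast ArithmeticFunction.abs_moebius_le_one (n := d)

/-- The Möbius factor truncates each local series to 1 - `coprimeInvSq N p`, so this Euler product
is the inverse, factor by factor, of that of ζ_N(2). -/
theorem tsum_moebius_mul_coprimeInvSq (N : ℕ) :
    ∑' d : ℕ, (ArithmeticFunction.moebius d : ℝ) * coprimeInvSq N d = (zetaN N 2)⁻¹ := by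
  set h : ℕ → ℝ := fun d => (ArithmeticFunction.moebius d : ℝ) * coprimeInvSq N d with hh
  have hs : Summable (fun d => ‖h d‖) := by
    refine Summable.of_nonneg_of_le (fun _ => norm_nonneg _) (fun d => ?_) summable_one_div_sq
    rw [hh, norm_mul, Real.norm_eq_abs, Real.norm_eq_abs, abs_of_nonneg (coprimeInvSq_nonneg N d)]
    exact (mul_le_of_le_one_left (coprimeInvSq_nonneg N d) (abs_moebius_cast_le_one d)).trans
      (coprimeInvSq_le N d)
  have h1 : h 1 = 1 := by simp [hh]
  have h0 : h 0 = 0 := by simp [hh]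
  have hmul : ∀ {m n : ℕ}, m.Coprime n → h (m * n) = h m * h n := by
    intro m n hmn
    simp only [hh]
    rw [ArithmeticFunction.isMultiplicative_moebius.map_mul_of_coprime hmn, map_mul]
    push_cast; ring
  have hP := EulerProduct.eulerProduct_hasProd h1 hmul hs h0
  have hloc : ∀ p : Nat.Primes, ∑' e : ℕ, h ((p : ℕ) ^ e) = 1 - coprimeInvSq N p := by
    intro p
    rw [tsum_eq_sum (s := Finset.range 2)]
    · rw [Finset.sum_range_succ, Finset.sum_range_one, pow_zero, pow_one, h1]
      simp only [hh]
      rw [ArithmeticFunction.moebius_apply_prime p.2]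
      push_cast; ring
    · intro e he
      rw [Finset.mem_range, not_lt] at he
      simp only [hh]
      rw [ArithmeticFunction.moebius_apply_prime_pow p.2 (by omega), if_neg (by omega)]
      simp
  simp only [hloc] at hP
  have hz : ∑' n, coprimeInvSq N n ≠ 0 := by
    rw [← zetaN_two_eq_tsum]; exact (zetaN_two_pos N).ne'
  have hQ := (hasProd_coprimeInvSq N).inv₀ hz
  simp only [inv_inv] at hQ
  rw [hP.unique hQ, zetaN_two_eq_tsum]

theorem abs_card_filter_modEq_sub_le {m : ℕ} (hm : 0 < m) (a : ℤ) (Q : ℕ) :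
    |(((Finset.Icc 1 Q).filter (fun q : ℕ => (q : ℤ) ≡ a [ZMOD m])).card : ℝ) - Q / m| ≤ 1 := by
  have hm' : (0 : ℤ) < m := by exact_mod_cast hm
  have h := Int.Ioc_filter_modEq_card 0 (Q : ℤ) hm' a
  have e : ((Finset.Icc 1 Q).filter (fun q : ℕ => (q : ℤ) ≡ a [ZMOD m])).card =
      ((Finset.Ioc (0 : ℤ) Q).filter (fun q => q ≡ a [ZMOD m])).card := by
    refine Finset.card_nbij' (fun q : ℕ => (q : ℤ)) Int.toNat ?_ ?_ ?_ ?_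
    · intro q hq
      simp only [Finset.coe_filter, Finset.mem_Icc, Finset.mem_Ioc, Set.mem_ofPred_eq] at hq ⊢
      exact ⟨by omega, hq.2⟩
    · intro q hq
      simp only [Finset.coe_filter, Finset.mem_Icc, Finset.mem_Ioc, Set.mem_ofPred_eq] at hq ⊢
      rw [Int.toNat_of_nonneg hq.1.1.le]
      exact ⟨by omega, hq.2⟩
    · intro q _; simp
    · intro q hq
      simp only [Finset.coe_filter, Finset.mem_Ioc, Set.mem_ofPred_eq] at hq
      exact Int.toNat_of_nonneg hq.1.1.le
  rw [← e] at h
  have hle : (((0 : ℤ) : ℚ) - a) / ((m : ℤ) : ℚ) ≤ (((Q : ℤ) : ℚ) - a) / ((m : ℤ) : ℚ) := by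
    have : (0 : ℚ) < ((m : ℤ) : ℚ) := by exact_mod_cast hm
    gcongr
    simp
  rw [max_eq_left (sub_nonneg.2 (Int.floor_mono hle))] at h
  have h' : (((Finset.Icc 1 Q).filter (fun q : ℕ => (q : ℤ) ≡ a [ZMOD m])).card : ℚ) =
    ⌊(((Q : ℤ) : ℚ) - a) / ((m : ℤ) : ℚ)⌋ - ⌊(((0 : ℤ) : ℚ) - a) / ((m : ℤ) : ℚ)⌋ := by
    exact_mod_cast h
  have hq : |(((Finset.Icc 1 Q).filter (fun q : ℕ => (q : ℤ) ≡ a [ZMOD m])).card : ℚ) - Q / m|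
      ≤ 1 := by
    rw [h']
    have e2 : (Q : ℚ) / m = (((Q : ℤ) : ℚ) - a) / ((m : ℤ) : ℚ) -
        (((0 : ℤ) : ℚ) - a) / ((m : ℤ) : ℚ) := by
      push_cast; ring
    rw [e2, abs_le]
    have f1 := Int.floor_le ((((Q : ℤ) : ℚ) - a) / ((m : ℤ) : ℚ))
    have f2 := Int.lt_floor_add_one ((((Q : ℤ) : ℚ) - a) / ((m : ℤ) : ℚ))
    have f3 := Int.floor_le ((((0 : ℤ) : ℚ) - a) / ((m : ℤ) : ℚ))
    have f4 := Int.lt_floor_add_one ((((0 : ℤ) : ℚ) - a) / ((m : ℤ) : ℚ))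
    constructor <;> linarith
  have hR := (Rat.cast_le (K := ℝ)).2 hq
  push_cast at hR
  exact hR

theorem tendsto_card_filter_modEq_div {m : ℕ} (hm : 0 < m) (a : ℤ) :
    Tendsto (fun Q : ℕ =>
      (((Finset.Icc 1 Q).filter (fun q : ℕ => (q : ℤ) ≡ a [ZMOD m])).card : ℝ) / Q) atTop
      (nhds (1 / (m : ℝ))) := by
  rw [tendsto_iff_norm_sub_tendsto_zero]
  refine squeeze_zero' (Eventually.of_forall fun _ => norm_nonneg _) ?_
    tendsto_one_div_atTop_nhds_zero_nat
  filter_upwards [eventually_gt_atTop 0] with Q hQ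
  have hQR : (0 : ℝ) < Q := by exact_mod_cast hQ
  have h := abs_card_filter_modEq_sub_le hm a Q
  have hmR : (0 : ℝ) < m := by exact_mod_cast hm
  have e : ∀ c : ℝ, c / Q - 1 / m = (c - Q / m) / Q := fun c => by field_simp
  rw [e, Real.norm_eq_abs, abs_div, abs_of_pos hQR]
  gcongr

/-- After exchanging sums, the term for d coprime to N is μ(d)/d times the proportion of q ≤ Q with
q ≡ q₀ mod N and d ∣ q. This proportion tends to 1/(Nd) and never exceeds 1/d, so dominated
convergence applies with majorant 1/d². -/
theorem tendsto_average_phiRatio {N : ℕ} (hN : 0 < N) (q₀ : ℤ) :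
    Tendsto (fun Q : ℕ => (∑ q ∈ Finset.Icc 1 Q,
      if (q : ℤ) ≡ q₀ [ZMOD N] then phiRatio N q else 0) / Q) atTop
      (nhds (1 / (zetaN N 2 * N))) := by
  set C : ℕ → ℕ → ℝ := fun Q d =>
    (((Finset.Icc 1 Q).filter (fun q : ℕ => (q : ℤ) ≡ q₀ [ZMOD N] ∧ (d : ℤ) ∣ q)).card : ℝ) with hC
  set T : ℕ → ℕ → ℝ := fun Q d => if d.Coprime N then
    (ArithmeticFunction.moebius d : ℝ) / d * (C Q d / Q) else 0 with hT
  have hCle : ∀ Q d : ℕ, 0 < d → C Q d / Q ≤ 1 / d := by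
    intro Q d hd
    rcases Nat.eq_zero_or_pos Q with rfl | hQ
    · simp
    have hQR : (0 : ℝ) < Q := by exact_mod_cast hQ
    have hdR : (0 : ℝ) < d := by exact_mod_cast hd
    have h1 : ((Finset.Icc 1 Q).filter (fun q : ℕ => (q : ℤ) ≡ q₀ [ZMOD N] ∧ (d : ℤ) ∣ q)).card
        ≤ Q / d := by
      calc _ ≤ ((Finset.Icc 1 Q).filter (fun q => d ∣ q)).card :=
            Finset.card_le_card (Finset.monotone_filter_right _ fun q _ hq => by exact_mod_cast hq.2)
        _ ≤ Q / d := by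
            rw [filter_dvd_Icc_eq_image hd]
            exact Finset.card_image_le.trans (by simp)
    have h2 : C Q d ≤ Q / d :=
      (show C Q d ≤ ((Q / d : ℕ) : ℝ) from Nat.cast_le.2 h1).trans Nat.cast_div_le
    rw [div_le_iff₀ hQR]
    linarith [show (1 : ℝ) / d * Q = Q / d by ring]
  have hsum : ∀ Q : ℕ, (∑ q ∈ Finset.Icc 1 Q,
      if (q : ℤ) ≡ q₀ [ZMOD N] then phiRatio N q else 0) / Q = ∑' d, T Q d := by
    intro Q
    rw [tsum_eq_sum (s := Finset.Icc 1 Q)]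
    · have e : ∀ q ∈ Finset.Icc 1 Q, (if (q : ℤ) ≡ q₀ [ZMOD N] then phiRatio N q else 0) =
          ∑ d ∈ Finset.Icc 1 Q, if d.Coprime N then (ArithmeticFunction.moebius d : ℝ) / d *
            (if (q : ℤ) ≡ q₀ [ZMOD N] ∧ (d : ℤ) ∣ q then 1 else 0) else 0 := by
        intro q hq
        rw [Finset.mem_Icc] at hq
        by_cases hqq : (q : ℤ) ≡ q₀ [ZMOD N]
        · simp only [hqq, if_true, true_and, mul_ite, mul_one, mul_zero]
          rw [phiRatio, ← Finset.sum_filter, ← Finset.sum_filter, Finset.filter_filter]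
          refine Finset.sum_congr ?_ fun _ _ => rfl
          ext d
          simp only [Finset.mem_filter, Nat.mem_divisors, Finset.mem_Icc, Int.natCast_dvd_natCast]
          constructor
          · rintro ⟨⟨h1, h2⟩, h3⟩
            exact ⟨⟨Nat.pos_of_dvd_of_pos h1 hq.1, (Nat.le_of_dvd hq.1 h1).trans hq.2⟩, h3, h1⟩
          · rintro ⟨-, h3, h1⟩
            exact ⟨⟨h1, by omega⟩, h3⟩
        · simp [hqq]
      rw [Finset.sum_congr rfl e, Finset.sum_comm, Finset.sum_div]
      refine Finset.sum_congr rfl fun d _ => ?_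
      simp only [hT, hC]
      split_ifs
      · rw [← Finset.mul_sum, mul_div_assoc, Finset.sum_boole]
      · simp
    · intro d hd
      simp only [hT]
      split_ifs
      swap
      · rfl
      rcases Nat.eq_zero_or_pos d with rfl | hdpos
      · simp
      have : C Q d = 0 := by
        simp only [hC, Nat.cast_eq_zero, Finset.card_eq_zero, Finset.filter_eq_empty_iff,
          Finset.mem_Icc, Int.natCast_dvd_natCast]
        rintro q ⟨h1, h2⟩ ⟨-, h3⟩
        exact hd (Finset.mem_Icc.2 ⟨hdpos, (Nat.le_of_dvd h1 h3).trans h2⟩)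
      rw [this]; simp
  have hlim : 1 / (zetaN N 2 * N) =
      ∑' d : ℕ, (ArithmeticFunction.moebius d : ℝ) * coprimeInvSq N d * (1 / N) := by
    rw [tsum_mul_right, tsum_moebius_mul_coprimeInvSq, one_div, one_div, mul_inv]
  simp only [hsum]
  rw [hlim]
  refine tendsto_tsum_of_dominated_convergence summable_one_div_sq ?_ ?_
  · intro d
    simp only [hT, coprimeInvSq_apply]
    split_ifs with hd
    swap
    · simp
    rcases Nat.eq_zero_or_pos d with rfl | hdpos
    · simp
    obtain ⟨a, -, -, -, ha⟩ := exists_modEq_iff_of_coprime hN hdpos hd q₀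
    have h := tendsto_card_filter_modEq_div (m := N * d) (by positivity) a
    have e : ∀ Q, C Q d =
        (((Finset.Icc 1 Q).filter (fun q : ℕ => (q : ℤ) ≡ a [ZMOD (N * d : ℕ)])).card : ℝ) := by
      intro Q
      simp only [hC]
      push_cast
      simp only [ha]
    simp only [e]
    convert! h.const_mul ((ArithmeticFunction.moebius d : ℝ) / d) using 2
    push_cast
    field_simp
  · refine Eventually.of_forall fun Q d => ?_
    simp only [hT]
    split_ifs
    swap
    · rw [norm_zero]; positivity
    rcases Nat.eq_zero_or_pos d with rfl | hdpos
    · simp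
    have hdR : (0 : ℝ) < d := by exact_mod_cast hdpos
    have h0 : 0 ≤ C Q d / Q := by positivity
    rw [norm_mul, norm_div, Real.norm_eq_abs, Real.norm_eq_abs, Real.norm_eq_abs,
      abs_of_nonneg h0, abs_of_pos hdR]
    calc _ ≤ 1 / (d : ℝ) * (1 / d) :=
          mul_le_mul (div_le_div_of_nonneg_right (abs_moebius_cast_le_one d) hdR.le)
            (hCle Q d hdpos) h0 (by positivity)
      _ = _ := by rw [one_div_mul_one_div, pow_two]

/-! ### Passing from plain to weighted averages -/

/-- Abel summation: the decrements of f are nonnegative, so the bound ε n + C on partial sums of b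
turns into the same combination for the weight f. -/
theorem PosAntitone.abs_sum_mul_le {f b : ℕ → ℝ} (hf : PosAntitone f) {ε C : ℝ}
    (hC : 0 ≤ C) (hb : ∀ n : ℕ, |∑ q ∈ Finset.Icc 1 n, b q| ≤ ε * n + C) (n : ℕ) :
    |∑ q ∈ Finset.Icc 1 n, f q * b q| ≤ ε * ∑ q ∈ Finset.Icc 1 n, f q + C * f 1 := by
  -- With the boundary term removed, each induction step adds exactly one decrement of f times a
  -- partial sum of b.
  have key : ∀ m : ℕ, |∑ q ∈ Finset.Icc 1 (m + 1), f q * b q -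
      f (m + 1) * ∑ q ∈ Finset.Icc 1 (m + 1), b q| ≤
      ε * (∑ q ∈ Finset.Icc 1 (m + 1), f q - (m + 1 : ℕ) * f (m + 1)) + C * (f 1 - f (m + 1)) := by
    intro m
    induction m with
    | zero => simp
    | succ m ih =>
      have hd : 0 ≤ f (m + 1) - f (m + 1 + 1) := sub_nonneg.2 (hf.anti _ _ (by omega) (by omega))
      have h1 := hb (m + 1)
      have hs : ∀ g : ℕ → ℝ, ∑ q ∈ Finset.Icc 1 (m + 1 + 1), g q =
          ∑ q ∈ Finset.Icc 1 (m + 1), g q + g (m + 1 + 1) := fun g =>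
        Finset.sum_Icc_succ_top (by omega) g
      rw [hs, hs, hs]
      set B := ∑ q ∈ Finset.Icc 1 (m + 1), b q
      set G := ∑ q ∈ Finset.Icc 1 (m + 1), f q * b q
      set P := ∑ q ∈ Finset.Icc 1 (m + 1), f q
      have e : G + f (m + 1 + 1) * b (m + 1 + 1) - f (m + 1 + 1) * (B + b (m + 1 + 1)) =
          (G - f (m + 1) * B) + (f (m + 1) - f (m + 1 + 1)) * B := by ring
      rw [e]
      refine (abs_add_le _ _).trans ?_
      rw [abs_mul, abs_of_nonneg hd]
      have h2 := mul_le_mul_of_nonneg_left h1 hd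
      push_cast at h2 ih ⊢
      linarith
  rcases n with _ | m
  · simp only [Finset.Icc_eq_empty_of_lt one_pos, Finset.sum_empty, abs_zero, mul_zero, zero_add]
    exact mul_nonneg hC (hf.pos 1 one_pos).le
  · have h1 := key m
    have h2 := mul_le_mul_of_nonneg_left (hb (m + 1)) (hf.pos (m + 1) m.succ_pos).le
    rw [← abs_of_pos (hf.pos (m + 1) m.succ_pos), ← abs_mul,
      abs_of_pos (hf.pos (m + 1) m.succ_pos)] at h2
    have h3 := abs_add_le (∑ q ∈ Finset.Icc 1 (m + 1), f q * b q -
      f (m + 1) * ∑ q ∈ Finset.Icc 1 (m + 1), b q) (f (m + 1) * ∑ q ∈ Finset.Icc 1 (m + 1), b q)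
    rw [sub_add_cancel] at h3
    linarith

theorem exists_le_mul_add_of_tendsto_div_zero {B : ℕ → ℝ}
    (h : Tendsto (fun n : ℕ => B n / n) atTop (nhds 0)) {ε : ℝ} (hε : 0 < ε) :
    ∃ C : ℝ, 0 ≤ C ∧ ∀ n : ℕ, |B n| ≤ ε * n + C := by
  obtain ⟨n₀, hn₀⟩ := (Metric.tendsto_atTop.1 h) ε hε
  refine ⟨∑ i ∈ Finset.range (n₀ + 1), |B i|, Finset.sum_nonneg fun _ _ => abs_nonneg _, ?_⟩
  intro n
  have hS : 0 ≤ ∑ i ∈ Finset.range (n₀ + 1), |B i| := Finset.sum_nonneg fun _ _ => abs_nonneg _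
  rcases le_or_gt n n₀ with hn | hn
  · have := Finset.single_le_sum (f := fun i => |B i|) (fun i _ => abs_nonneg _)
      (Finset.mem_range.2 (Nat.lt_succ_of_le hn))
    have : 0 ≤ ε * n := by positivity
    linarith
  · have h1 := hn₀ n hn.le
    have hnR : (0 : ℝ) < n := by exact_mod_cast (Nat.zero_le n₀).trans_lt hn
    rw [Real.dist_eq, sub_zero, abs_div, abs_of_pos hnR, div_lt_iff₀ hnR] at h1
    linarith

/-- Summation by parts: averaging against a non-increasing weight with divergent sum. -/
theorem PosAntitone.tendsto_weighted_average {f a : ℕ → ℝ} (hf : PosAntitone f)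
    (hdiv : Tendsto (fun n : ℕ => ∑ q ∈ Finset.Icc 1 n, f q) atTop atTop) {α : ℝ}
    (ha : Tendsto (fun n : ℕ => (∑ q ∈ Finset.Icc 1 n, a q) / n) atTop (nhds α)) :
    Tendsto (fun n : ℕ => (∑ q ∈ Finset.Icc 1 n, f q * a q) / ∑ q ∈ Finset.Icc 1 n, f q) atTop
      (nhds α) := by
  have hb : Tendsto (fun n : ℕ => (∑ q ∈ Finset.Icc 1 n, (a q - α)) / n) atTop (nhds 0) := by
    rw [← sub_self α]
    refine (ha.sub_const α).congr' ?_
    filter_upwards [eventually_gt_atTop 0] with n hn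
    have hnR : (n : ℝ) ≠ 0 := by positivity
    rw [Finset.sum_sub_distrib, Finset.sum_const, Nat.card_Icc, Nat.add_sub_cancel, nsmul_eq_mul]
    field_simp
  rw [Metric.tendsto_atTop']
  intro ε hε
  obtain ⟨C, hC, hCb⟩ := exists_le_mul_add_of_tendsto_div_zero hb (half_pos hε)
  obtain ⟨n₀, hn₀⟩ := (tendsto_atTop_atTop.1 hdiv) (2 * (C * f 1) / ε + 1)
  refine ⟨n₀, fun n hn => ?_⟩
  have hΨ := hn₀ n hn.le
  set Ψ := ∑ q ∈ Finset.Icc 1 n, f q with hΨd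
  have h1 := hf.abs_sum_mul_le hC hCb n
  have hf1 := hf.pos 1 one_pos
  have hpos : 0 < Ψ := lt_of_lt_of_le (by positivity) hΨ
  have e : (∑ q ∈ Finset.Icc 1 n, f q * a q) / Ψ - α =
      (∑ q ∈ Finset.Icc 1 n, f q * (a q - α)) / Ψ := by
    simp only [mul_sub, Finset.sum_sub_distrib, ← Finset.sum_mul]
    rw [← hΨd]
    field_simp
  rw [Real.dist_eq, e, abs_div, abs_of_pos hpos, div_lt_iff₀ hpos]
  have h2 : C * f 1 < ε / 2 * Ψ := by
    have h3 : 2 * (C * f 1) / ε < Ψ := by linarith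
    rw [div_lt_iff₀ hε] at h3
    linarith
  rw [← hΨd] at h1
  linarith

/-- The 2 comes from the interval |q x - p| < f(q). One factor N is the density of q ≡ q₀ mod N, the
other is the length of the period. -/
theorem PosAntitone.tendsto_sum_meanCount_div {f : ℕ → ℝ} (hf : PosAntitone f)
    (hdiv : Tendsto (fun n : ℕ => ∑ q ∈ Finset.Icc 1 n, f q) atTop atTop) {N : ℕ} (hN : 0 < N)
    (q₀ : ℤ) :
    Tendsto (fun n : ℕ => ((∑ q ∈ Finset.Icc 1 n, meanCount f N q₀ q) / N) /
      ∑ q ∈ Finset.Icc 1 n, f q) atTop (nhds (2 / (zetaN N 2 * N ^ 2))) := by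
  have h := (hf.tendsto_weighted_average hdiv (tendsto_average_phiRatio hN q₀)).const_mul (2 / (N : ℝ))
  have hNR : (N : ℝ) ≠ 0 := by positivity
  convert! h using 2 with n
  · have : ∑ q ∈ Finset.Icc 1 n, meanCount f N q₀ q = 2 * ∑ q ∈ Finset.Icc 1 n,
        f q * (if (q : ℤ) ≡ q₀ [ZMOD N] then phiRatio N q else 0) := by
      rw [Finset.mul_sum]
      refine Finset.sum_congr rfl fun q _ => ?_
      unfold meanCount
      split_ifs <;> ring
    rw [this]; ring
  · have := (zetaN_two_pos N).ne'
    field_simp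

/-! ### Almost everywhere convergence -/

/-- Interpolation from a subsequence along which the normalisation grows polynomially. -/
theorem tendsto_div_of_tendsto_subseq {S Ψ : ℕ → ℝ} (hS : Monotone S) (hS0 : ∀ n, 0 ≤ S n)
    (hΨm : StrictMono Ψ) (hΨ : Tendsto Ψ atTop atTop) {C c : ℝ} {n : ℕ → ℕ}
    (h1 : ∀ j : ℕ, (j : ℝ) ^ 8 ≤ Ψ (n j)) (h2 : ∀ j : ℕ, Ψ (n j) ≤ (j : ℝ) ^ 8 + C)
    (h3 : ∀ j m : ℕ, (j : ℝ) ^ 8 ≤ Ψ m → n j ≤ m)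
    (h : Tendsto (fun j => S (n j) / Ψ (n j)) atTop (nhds c)) :
    Tendsto (fun m => S m / Ψ m) atTop (nhds c) := by
  -- J m is chosen with (J m)⁸ ≤ Ψ m ≤ (J m + 1)⁸ for large m, so S m lies between its values at n
  -- (J m) and n (J m + 1). The normalisations there differ by factors tending to 1.
  set J : ℕ → ℕ := fun m => ⌊(Ψ m) ^ (1 / 8 : ℝ)⌋₊ with hJ
  have hJt : Tendsto J atTop atTop :=
    tendsto_nat_floor_atTop.comp ((tendsto_rpow_atTop (by norm_num)).comp hΨ)
  have hratio : Tendsto (fun j : ℕ => ((j : ℝ) / (j + 1)) ^ 8) atTop (nhds 1) := by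
    have := (tendsto_natCast_div_add_atTop (1 : ℝ)).pow 8
    simpa using this
  have hratio' : Tendsto (fun j : ℕ => (((j : ℝ) + 1) ^ 8 + C) / (j : ℝ) ^ 8) atTop (nhds 1) := by
    have t1 : Tendsto (fun j : ℕ => (((j : ℝ) / (j + 1)) ^ 8)⁻¹) atTop (nhds 1) := by
      simpa using hratio.inv₀ one_ne_zero
    have t2 : Tendsto (fun j : ℕ => C * ((j : ℝ) ^ 8)⁻¹) atTop (nhds 0) := by
      have := ((tendsto_pow_atTop (α := ℝ) (n := 8) (by norm_num)).comp
        tendsto_natCast_atTop_atTop).inv_tendsto_atTop.const_mul C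
      simpa using this
    have := t1.add t2
    rw [add_zero] at this
    refine this.congr fun j => ?_
    rw [div_pow, inv_div, add_div, div_eq_mul_inv C]
  have hlow : Tendsto (fun j : ℕ => S (n j) / Ψ (n j) * ((j : ℝ) / (j + 1)) ^ 8) atTop (nhds c) := by
    simpa using h.mul hratio
  have hup : Tendsto (fun j : ℕ => S (n (j + 1)) / Ψ (n (j + 1)) *
      ((((j : ℝ) + 1) ^ 8 + C) / (j : ℝ) ^ 8)) atTop (nhds c) := by
    simpa using (h.comp (tendsto_add_atTop_nat 1)).mul hratio'
  have hJle : ∀ᶠ m in atTop, 0 < J m ∧ (J m : ℝ) ^ 8 ≤ Ψ m ∧ Ψ m ≤ ((J m : ℝ) + 1) ^ 8 := by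
    filter_upwards [hΨ.eventually_ge_atTop 0, hJt.eventually_gt_atTop 0] with m hm hm'
    have e : ((Ψ m) ^ (1 / 8 : ℝ)) ^ 8 = Ψ m := by
      rw [← Real.rpow_natCast, ← Real.rpow_mul hm]; norm_num
    have hnn : 0 ≤ (Ψ m) ^ (1 / 8 : ℝ) := by positivity
    refine ⟨hm', ?_, ?_⟩
    · calc (J m : ℝ) ^ 8 ≤ ((Ψ m) ^ (1 / 8 : ℝ)) ^ 8 :=
            pow_le_pow_left₀ (Nat.cast_nonneg _) (Nat.floor_le hnn) 8
        _ = Ψ m := e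
    · calc Ψ m = ((Ψ m) ^ (1 / 8 : ℝ)) ^ 8 := e.symm
        _ ≤ ((J m : ℝ) + 1) ^ 8 := pow_le_pow_left₀ hnn (Nat.lt_floor_add_one _).le 8
  refine tendsto_of_tendsto_of_tendsto_of_le_of_le' (hlow.comp hJt) (hup.comp hJt) ?_ ?_
  · filter_upwards [hJle] with m hm
    obtain ⟨hm0, hm1, hm2⟩ := hm
    have hj : (0 : ℝ) < J m := by exact_mod_cast hm0
    have hΨpos : 0 < Ψ m := lt_of_lt_of_le (by positivity) hm1
    have hΨn : 0 < Ψ (n (J m)) := lt_of_lt_of_le (by positivity) (h1 _)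
    have hSle : S (n (J m)) ≤ S m := hS (h3 _ _ hm1)
    simp only [Function.comp]
    calc S (n (J m)) / Ψ (n (J m)) * ((J m : ℝ) / (J m + 1)) ^ 8
        = S (n (J m)) * ((J m : ℝ) ^ 8 / Ψ (n (J m))) / ((J m : ℝ) + 1) ^ 8 := by
          rw [div_pow]; ring
      _ ≤ S (n (J m)) * 1 / ((J m : ℝ) + 1) ^ 8 := by
          have := hS0 (n (J m))
          have : (J m : ℝ) ^ 8 / Ψ (n (J m)) ≤ 1 := (div_le_one hΨn).2 (h1 _)
          gcongr
      _ ≤ S m / Ψ m := by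
          rw [mul_one]
          exact div_le_div₀ (hS0 m) hSle hΨpos hm2
  · filter_upwards [hJle] with m hm
    obtain ⟨hm0, hm1, hm2⟩ := hm
    have hj : (0 : ℝ) < J m := by exact_mod_cast hm0
    have hΨpos : 0 < Ψ m := lt_of_lt_of_le (by positivity) hm1
    have hm2' : Ψ m ≤ Ψ (n (J m + 1)) := by
      refine hm2.trans ?_
      have := h1 (J m + 1)
      push_cast at this
      exact this
    have hΨn : 0 < Ψ (n (J m + 1)) := hΨpos.trans_le hm2'
    have hSle : S m ≤ S (n (J m + 1)) := hS (hΨm.le_iff_le.1 hm2')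
    have h2' : Ψ (n (J m + 1)) ≤ ((J m : ℝ) + 1) ^ 8 + C := by
      have := h2 (J m + 1)
      push_cast at this
      exact this
    simp only [Function.comp]
    calc S m / Ψ m ≤ S (n (J m + 1)) / (J m : ℝ) ^ 8 :=
          div_le_div₀ (hS0 _) hSle (by positivity) hm1
      _ = S (n (J m + 1)) / Ψ (n (J m + 1)) * (Ψ (n (J m + 1)) / (J m : ℝ) ^ 8) := by
          field_simp
      _ ≤ _ := by
          have := hS0 (n (J m + 1))
          gcongr

theorem strictMono_sum_Icc {f : ℕ → ℝ} (hf : PosAntitone f) :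
    StrictMono fun n : ℕ => ∑ q ∈ Finset.Icc 1 n, f q := by
  refine strictMono_nat_of_lt_succ fun n => ?_
  simp only [Finset.sum_Icc_succ_top (show 1 ≤ n + 1 by omega)]
  exact lt_add_of_pos_right _ (hf.pos _ n.succ_pos)

/-- Take the first index at which the partial sum reaches j⁸. The overshoot is at most its last
term, hence at most f 1. -/
theorem PosAntitone.exists_subseq {f : ℕ → ℝ} (hf : PosAntitone f)
    (hdiv : Tendsto (fun n : ℕ => ∑ q ∈ Finset.Icc 1 n, f q) atTop atTop) :
    ∃ n : ℕ → ℕ, (∀ j : ℕ, (j : ℝ) ^ 8 ≤ ∑ q ∈ Finset.Icc 1 (n j), f q) ∧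
      (∀ j : ℕ, ∑ q ∈ Finset.Icc 1 (n j), f q ≤ (j : ℝ) ^ 8 + f 1) ∧
      (∀ j m : ℕ, (j : ℝ) ^ 8 ≤ ∑ q ∈ Finset.Icc 1 m, f q → n j ≤ m) ∧ Tendsto n atTop atTop := by
  classical
  have hex : ∀ j : ℕ, ∃ n : ℕ, (j : ℝ) ^ 8 ≤ ∑ q ∈ Finset.Icc 1 n, f q := fun j =>
    (hdiv.eventually_ge_atTop _).exists
  refine ⟨fun j => Nat.find (hex j), fun j => Nat.find_spec (hex j), fun j => ?_,
    fun j m h => Nat.find_min' (hex j) h, ?_⟩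
  · have hf1 := hf.pos 1 one_pos
    change ∑ q ∈ Finset.Icc 1 (Nat.find (hex j)), f q ≤ _
    rcases h : Nat.find (hex j) with _ | k
    · simp only [Finset.Icc_eq_empty_of_lt one_pos, Finset.sum_empty]
      positivity
    · have hk := Nat.find_min (hex j) (m := k) (by omega)
      rw [not_le] at hk
      rw [Finset.sum_Icc_succ_top (by omega)]
      exact add_le_add hk.le (hf.anti _ _ one_pos (by omega))
  · rw [tendsto_atTop]
    intro b
    filter_upwards [((tendsto_pow_atTop (α := ℝ) (n := 8) (by norm_num)).comp
        tendsto_natCast_atTop_atTop).eventually_gt_atTop (∑ q ∈ Finset.Icc 1 b, f q)] with j hj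
    exact ((strictMono_sum_Icc hf).lt_iff_lt.1 (hj.trans_le (Nat.find_spec (hex j)))).le

/-- This plays the role of Chebyshev with Borel–Cantelli: the series of squares has finite integral,
so it converges almost everywhere and its terms tend to 0. -/
theorem ae_tendsto_zero_of_integral_sq_le {α : Type*} [MeasurableSpace α] {μ : Measure α}
    {g : ℕ → α → ℝ} {b : ℕ → ℝ} (hb : Summable b) (hm : ∀ j, Measurable (g j))
    (hi : ∀ j, Integrable (fun x => g j x ^ 2) μ) (h : ∀ j, ∫ x, g j x ^ 2 ∂μ ≤ b j) :
    ∀ᵐ x ∂μ, Tendsto (fun j => g j x) atTop (nhds 0) := by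
  have hmeas : ∀ j, Measurable fun x => ENNReal.ofReal (g j x ^ 2) := fun j =>
    ((hm j).pow_const 2).ennreal_ofReal
  have hfin : ∫⁻ x, ∑' j, ENNReal.ofReal (g j x ^ 2) ∂μ ≠ ⊤ := by
    rw [lintegral_tsum fun j => (hmeas j).aemeasurable]
    refine ne_top_of_le_ne_top hb.tsum_ofReal_ne_top (ENNReal.tsum_le_tsum fun j => ?_)
    rw [← ofReal_integral_eq_lintegral_ofReal (hi j) (Eventually.of_forall fun x => sq_nonneg _)]
    exact ENNReal.ofReal_le_ofReal (h j)
  filter_upwards [ae_lt_top (Measurable.tsum hmeas) hfin] with x hx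
  have h1 := ENNReal.tendsto_atTop_zero_of_tsum_ne_top hx.ne
  have h2 := (ENNReal.tendsto_toReal ENNReal.zero_ne_top).comp h1
  have h3 : Tendsto (fun j => g j x ^ 2) atTop (nhds 0) := by
    refine h2.congr fun j => ?_
    exact ENNReal.toReal_ofReal (sq_nonneg _)
  have h4 := h3.sqrt
  simp only [Real.sqrt_sq_eq_abs, Real.sqrt_zero] at h4
  exact (tendsto_zero_iff_abs_tendsto_zero _).2 h4

theorem PosAntitone.ae_restrict_tendsto {f : ℕ → ℝ} (hf : PosAntitone f)
    (hdiv : Tendsto (fun n : ℕ => ∑ q ∈ Finset.Icc 1 n, f q) atTop atTop) {N : ℕ} (hN : 0 < N)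
    {p₀ q₀ : ℤ} (hgcd : Nat.gcd (Int.gcd p₀ q₀) N = 1) :
    ∀ᵐ x ∂(volume.restrict (Set.Ioc 0 (N : ℝ))),
      Tendsto (fun n : ℕ => (∑ q ∈ Finset.Icc 1 n, approxCount f N p₀ q₀ q x) /
        ∑ q ∈ Finset.Icc 1 n, f q) atTop (nhds (2 / (zetaN N 2 * N ^ 2))) := by
  obtain ⟨n, h1, h2, h3, hn⟩ := hf.exists_subseq hdiv
  set Ψ : ℕ → ℝ := fun n => ∑ q ∈ Finset.Icc 1 n, f q with hΨ
  set S : ℕ → ℝ → ℝ := fun n x => ∑ q ∈ Finset.Icc 1 n, approxCount f N p₀ q₀ q x with hS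
  set m : ℕ → ℝ := fun n => (∑ q ∈ Finset.Icc 1 n, meanCount f N q₀ q) / N with hm
  have hmlim : Tendsto (fun n => m n / Ψ n) atTop (nhds (2 / (zetaN N 2 * N ^ 2))) :=
    hf.tendsto_sum_meanCount_div hdiv hN q₀
  have hSmeas : ∀ n, Measurable (S n) := fun n =>
    Finset.measurable_fun_sum _ fun q _ => measurable_approxCount f N p₀ q₀ q
  have hsum : Summable fun j : ℕ => 30 / ((j + 1 : ℕ) : ℝ) ^ 2 := by
    have := ((summable_nat_add_iff 1).2 summable_one_div_sq).mul_left 30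
    refine this.congr fun j => ?_
    rw [mul_one_div]
  have hvar : ∀ j : ℕ, Integrable (fun x => ((S (n (j + 1)) x - m (n (j + 1))) / Ψ (n (j + 1))) ^ 2)
      (volume.restrict (Set.Ioc 0 (N : ℝ))) ∧
      ∫ x in Set.Ioc 0 (N : ℝ), ((S (n (j + 1)) x - m (n (j + 1))) / Ψ (n (j + 1))) ^ 2 ≤
        30 / ((j + 1 : ℕ) : ℝ) ^ 2 := by
    intro j
    set k := j + 1 with hk
    have hkpos : 0 < k := j.succ_pos
    -- With K = k² and Ψ ≥ k⁸, the terms 8K³Ψ, 20Ψ²/K and 2Ψ are at most 8, 20 and 2 times Ψ²/k²,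
    -- whence the constant 30.
    obtain ⟨i1, i2⟩ := hf.integral_sq_sub_le hN hgcd (K := k ^ 2) (by positivity) (n k)
    simp only [div_pow]
    refine ⟨i1.div_const _, ?_⟩
    have hkR : (0 : ℝ) < k := by exact_mod_cast hkpos
    have hk1 : (1 : ℝ) ≤ k := by exact_mod_cast hkpos
    have hkΨ : (k : ℝ) ^ 8 ≤ Ψ (n k) := h1 k
    have hΨpos : 0 < Ψ (n k) := lt_of_lt_of_le (by positivity) hkΨ
    rw [integral_div, div_le_iff₀ (by positivity)]
    refine i2.trans ?_
    simp only [hΨ] at hkΨ hΨpos ⊢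
    set P := ∑ q ∈ Finset.Icc 1 (n k), f q
    push_cast
    rw [show (30 : ℝ) / (k : ℝ) ^ 2 * P ^ 2 = 20 * P ^ 2 / (k : ℝ) ^ 2 + 10 * (P * P) / (k : ℝ) ^ 2
      by ring]
    have e1 : 8 * ((k : ℝ) ^ 2) ^ 3 * P ≤ 8 * (P * P) / (k : ℝ) ^ 2 := by
      rw [le_div_iff₀ (by positivity)]
      calc 8 * ((k : ℝ) ^ 2) ^ 3 * P * (k : ℝ) ^ 2 = 8 * ((k : ℝ) ^ 8 * P) := by ring
        _ ≤ _ := by gcongr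
    have e2 : 2 * P ≤ 2 * (P * P) / (k : ℝ) ^ 2 := by
      rw [le_div_iff₀ (by positivity)]
      calc 2 * P * (k : ℝ) ^ 2 ≤ 2 * P * (k : ℝ) ^ 8 := by
            gcongr
            norm_num
        _ ≤ 2 * P * P := by gcongr
        _ = _ := by ring
    have e3 : 10 * (P * P) / (k : ℝ) ^ 2 = 8 * (P * P) / (k : ℝ) ^ 2 + 2 * (P * P) / (k : ℝ) ^ 2 := by
      ring
    rw [e3]
    linarith
  filter_upwards [ae_tendsto_zero_of_integral_sq_le hsum
    (fun j => ((hSmeas (n (j + 1))).sub_const _).div_const _) (fun j => (hvar j).1)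
    (fun j => (hvar j).2)] with x hx
  have h4 : Tendsto (fun j => S (n j) x / Ψ (n j)) atTop (nhds (2 / (zetaN N 2 * N ^ 2))) := by
    rw [← tendsto_add_atTop_iff_nat 1]
    have := hx.add ((hmlim.comp hn).comp (tendsto_add_atTop_nat 1))
    rw [zero_add] at this
    refine this.congr fun j => ?_
    simp only [Function.comp]
    ring
  refine tendsto_div_of_tendsto_subseq (S := fun n => S n x) (C := f 1) ?_ ?_
    (strictMono_sum_Icc hf) hdiv h1 h2 h3 h4
  · intro a b hab
    exact Finset.sum_le_sum_of_subset_of_nonneg (Finset.Icc_subset_Icc_right hab)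
      fun q _ _ => approxCount_nonneg f N p₀ q₀ q x
  · exact fun k => Finset.sum_nonneg fun q _ => approxCount_nonneg f N p₀ q₀ q x

theorem ae_of_ae_restrict_Ioc_of_periodic {P : ℝ → Prop} {T : ℝ} (hT : 0 < T)
    (hP : ∀ x, P (x + T) ↔ P x) (h : ∀ᵐ x ∂(volume.restrict (Set.Ioc 0 T)), P x) :
    ∀ᵐ x, P x := by
  have hP' : Function.Periodic P T := fun x => propext (hP x)
  rw [ae_restrict_iff' measurableSet_Ioc] at h
  have h1 : ∀ᵐ x : ℝ, ∀ k : ℤ, x - k • T ∈ Set.Ioc 0 T → P (x - k • T) :=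
    ae_all_iff.2 fun k =>
      (measurePreserving_sub_right volume (k • T)).quasiMeasurePreserving.ae h
  filter_upwards [h1] with x hx
  obtain ⟨k, hk, -⟩ := existsUnique_sub_zsmul_mem_Ioc hT x 0
  rw [zero_add] at hk
  have := hx k hk
  rwa [hP'.sub_zsmul_eq k] at this

theorem PosAntitone.ae_tendsto {f : ℕ → ℝ} (hf : PosAntitone f)
    (hdiv : Tendsto (fun n : ℕ => ∑ q ∈ Finset.Icc 1 n, f q) atTop atTop) {N : ℕ} (hN : 0 < N)
    {p₀ q₀ : ℤ} (hgcd : Nat.gcd (Int.gcd p₀ q₀) N = 1) :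
    ∀ᵐ x : ℝ, Tendsto (fun n : ℕ => (∑ q ∈ Finset.Icc 1 n, approxCount f N p₀ q₀ q x) /
        ∑ q ∈ Finset.Icc 1 n, f q) atTop (nhds (2 / (zetaN N 2 * N ^ 2))) := by
  refine ae_of_ae_restrict_Ioc_of_periodic (by exact_mod_cast hN) (fun x => ?_)
    (hf.ae_restrict_tendsto hdiv hN hgcd)
  simp only [approxCount_add_natCast]

/-! ### Both signs of the denominator and the conclusion -/

/-- Negation preserves primitivity and |q x - p| and carries the vectors with q < 0 to those with q
> 0 in the class of (-p₀, -q₀). Exhibiting the set as a finite set also makes `ncard` a genuine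
count. -/
theorem ncard_approxVectors (ψ : ℝ → ℝ) (p₀ q₀ : ℤ) (N : ℕ) (x T : ℝ) :
    ((approxVectors ψ p₀ q₀ N x T).ncard : ℝ) = ∑ q ∈ Finset.Icc 1 ⌊T⌋₊,
      (approxCount (fun q => ψ q) N p₀ q₀ q x + approxCount (fun q => ψ q) N (-p₀) (-q₀) q x) := by
  set A : ℤ → ℤ → ℕ → Set ℤ := fun a b q =>
    if (q : ℤ) ≡ b [ZMOD N] then {p | PrimNum N q a p ∧ |q * x - p| < ψ q} else ∅ with hA
  have hAfin : ∀ a b q, (A a b q).Finite := by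
    intro a b q
    simp only [hA]
    split_ifs
    · exact finite_hits _ _
    · exact Set.finite_empty
  have hcount : ∀ a b q, approxCount (fun q => ψ q) N a b q x = ((hAfin a b q).toFinset.card : ℝ) := by
    intro a b q
    rw [← Set.ncard_eq_toFinset_card _ (hAfin a b q)]
    simp only [approxCount, hA]
    split_ifs with h
    · have := finite_hits (P := PrimNum N q a) (q * x) (ψ q)
      rw [hits_eq_encard, ← this.cast_ncard_eq]
      simp
    · simp
  set F₁ : Finset (ℤ × ℤ) := (Finset.Icc 1 ⌊T⌋₊).biUnion fun q =>
    (hAfin p₀ q₀ q).toFinset.image fun p => (p, (q : ℤ)) with hF₁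
  set F₂ : Finset (ℤ × ℤ) := (Finset.Icc 1 ⌊T⌋₊).biUnion fun q =>
    (hAfin (-p₀) (-q₀) q).toFinset.image fun p => (-p, -(q : ℤ)) with hF₂
  have hc₁ : F₁.card = ∑ q ∈ Finset.Icc 1 ⌊T⌋₊, (hAfin p₀ q₀ q).toFinset.card := by
    rw [hF₁, Finset.card_biUnion]
    · exact Finset.sum_congr rfl fun q _ => Finset.card_image_of_injective _ fun a b h =>
        (Prod.ext_iff.1 h).1
    · intro q _ r _ hqr
      simp only [Function.onFun, Finset.disjoint_left, Finset.mem_image]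
      rintro v ⟨a, -, rfl⟩ ⟨b, -, h⟩
      exact hqr (Nat.cast_injective (R := ℤ) (Prod.ext_iff.1 h).2.symm)
  have hc₂ : F₂.card = ∑ q ∈ Finset.Icc 1 ⌊T⌋₊, (hAfin (-p₀) (-q₀) q).toFinset.card := by
    rw [hF₂, Finset.card_biUnion]
    · exact Finset.sum_congr rfl fun q _ => Finset.card_image_of_injective _ fun a b h =>
        neg_injective (Prod.ext_iff.1 h).1
    · intro q _ r _ hqr
      simp only [Function.onFun, Finset.disjoint_left, Finset.mem_image]
      rintro v ⟨a, -, rfl⟩ ⟨b, -, h⟩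
      exact hqr (by exact_mod_cast (neg_injective (Prod.ext_iff.1 h).2).symm)
  have hdisj : Disjoint F₁ F₂ := by
    simp only [hF₁, hF₂, Finset.disjoint_left, Finset.mem_biUnion, Finset.mem_image, Finset.mem_Icc]
    rintro v ⟨q, hq, a, -, rfl⟩ ⟨r, hr, b, -, h⟩
    have := (Prod.ext_iff.1 h).2
    simp only at this
    omega
  have hmem : ∀ a b q p, p ∈ (hAfin a b q).toFinset ↔
      ((q : ℤ) ≡ b [ZMOD N] ∧ PrimNum N q a p ∧ |q * x - p| < ψ q) := by
    intro a b q p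
    rw [Set.Finite.mem_toFinset]
    simp only [hA]
    split_ifs with h
    · simp only [h, true_and, Set.mem_ofPred_eq]
    · simp [h]
  have hset : approxVectors ψ p₀ q₀ N x T = ((F₁ ∪ F₂ : Finset (ℤ × ℤ)) : Set (ℤ × ℤ)) := by
    ext ⟨p, s⟩
    simp only [Finset.coe_union, Set.mem_union, Finset.mem_coe, hF₁, hF₂, Finset.mem_biUnion,
      Finset.mem_image, hmem, Finset.mem_Icc, Prod.mk.injEq, approxVectors, Set.mem_ofPred_eq]
    constructor
    · rintro ⟨h1, h2, h3, h4, h5, h6⟩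
      have hfl : s.natAbs ≤ ⌊T⌋₊ := Nat.le_floor (by
        rw [Nat.cast_natAbs]; push_cast; exact h5)
      have hs1 : 1 ≤ s.natAbs := Int.natAbs_pos.2 h4
      rcases lt_or_gt_of_ne h4 with hneg | hpos
      · have hsR : (s : ℝ) < 0 := by exact_mod_cast hneg
        have e : ((s.natAbs : ℕ) : ℤ) = -s := Int.ofNat_natAbs_of_nonpos hneg.le
        have eR : ((s.natAbs : ℕ) : ℝ) = -(s : ℝ) := by
          rw [← Int.cast_natCast, e, Int.cast_neg]
        rw [abs_of_neg hsR] at h6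
        refine Or.inr ⟨s.natAbs, ⟨hs1, hfl⟩, -p, ⟨?_, ⟨?_, h2.neg⟩, ?_⟩, neg_neg p, by omega⟩
        · rw [e]; exact h3.neg
        · rw [e, Int.gcd_neg, Int.neg_gcd]; exact h1
        · rw [eR, show -(s : ℝ) * x - ((-p : ℤ) : ℝ) = -(s * x - p) by push_cast; ring, abs_neg]
          exact h6
      · have hsR : (0 : ℝ) < s := by exact_mod_cast hpos
        have e : ((s.natAbs : ℕ) : ℤ) = s := Int.natAbs_of_nonneg hpos.le
        have eR : ((s.natAbs : ℕ) : ℝ) = (s : ℝ) := by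
          rw [← Int.cast_natCast, e]
        rw [abs_of_pos hsR] at h6
        refine Or.inl ⟨s.natAbs, ⟨hs1, hfl⟩, p, ⟨?_, ⟨?_, h2⟩, ?_⟩, rfl, e⟩
        · rw [e]; exact h3
        · rw [e]; exact h1
        · rw [eR]; exact h6
    · have hT : ∀ q : ℕ, 1 ≤ q → q ≤ ⌊T⌋₊ → (q : ℝ) ≤ T := fun q h1 h2 =>
        (Nat.le_floor_iff' (by omega)).1 h2
      rintro (⟨q, ⟨hq1, hq2⟩, p, ⟨h1, ⟨h2, h3⟩, h4⟩, rfl, rfl⟩ |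
        ⟨q, ⟨hq1, hq2⟩, p, ⟨h1, ⟨h2, h3⟩, h4⟩, rfl, rfl⟩)
      · refine ⟨h2, h3, h1, by omega, ?_, ?_⟩
        · rw [Int.cast_natCast, Nat.abs_cast]; exact hT q hq1 hq2
        · rw [Int.cast_natCast, Nat.abs_cast]; exact h4
      · refine ⟨by rw [Int.gcd_neg, Int.neg_gcd]; exact h2, by simpa using h3.neg,
          by simpa using h1.neg, by omega, ?_, ?_⟩
        · rw [Int.cast_neg, abs_neg, Int.cast_natCast, Nat.abs_cast]; exact hT q hq1 hq2
        · rw [Int.cast_neg, abs_neg, Int.cast_natCast, Nat.abs_cast,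
            show -(q : ℝ) * x - ((-p : ℤ) : ℝ) = -(q * x - p) by push_cast; ring, abs_neg]
          exact h4
  rw [hset, Set.ncard_coe_finset, Finset.card_union_of_disjoint hdisj, hc₁, hc₂]
  push_cast
  rw [← Finset.sum_add_distrib]
  exact Finset.sum_congr rfl fun q _ => by rw [hcount, hcount]

theorem theorem4 (ψ : ℝ → ℝ) (hψ_pos : ∀ t : ℝ, 0 < t → 0 < ψ t)
    (hψ_anti : AntitoneOn ψ (Set.Ioi 0))
    (hψ_div : Tendsto (fun n : ℕ => ∑ t ∈ Finset.Icc 1 n, ψ (t : ℝ)) atTop atTop)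
    (N : ℕ) (hN : 0 < N) (p₀ q₀ : ℤ) (hgcd : Nat.gcd (Int.gcd p₀ q₀) N = 1) :
    ∀ᵐ x : ℝ ∂volume,
      (fun T : ℝ => ((approxVectors ψ p₀ q₀ N x T).ncard : ℝ)) ~[atTop]
        (fun T : ℝ => 4 / (zetaN N 2 * (N : ℝ) ^ 2) *
          ∑ t ∈ Finset.Icc 1 ⌊T⌋₊, ψ (t : ℝ)) := by
  have hf : PosAntitone (fun q : ℕ => ψ q) :=
    ⟨fun q hq => hψ_pos q (by exact_mod_cast hq), fun q r hr hrq =>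
      hψ_anti (Set.mem_Ioi.2 (by exact_mod_cast hr))
        (Set.mem_Ioi.2 (by exact_mod_cast hr.trans_le hrq)) (by exact_mod_cast hrq)⟩
  have hgcd' : Nat.gcd (Int.gcd (-p₀) (-q₀)) N = 1 := by
    rw [Int.gcd_neg, Int.neg_gcd]; exact hgcd
  filter_upwards [hf.ae_tendsto hψ_div hN hgcd, hf.ae_tendsto hψ_div hN hgcd'] with x hx hx'
  have hz := zetaN_two_pos N
  have hNR : (0 : ℝ) < N := by exact_mod_cast hN
  have hΨ : ∀ᶠ T : ℝ in atTop, 0 < ∑ t ∈ Finset.Icc 1 ⌊T⌋₊, ψ (t : ℝ) :=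
    (hψ_div.comp tendsto_nat_floor_atTop).eventually_gt_atTop 0
  refine (isEquivalent_iff_tendsto_one ?_).2 ?_
  · filter_upwards [hΨ] with T hT
    positivity
  have h := (((hx.add hx').comp (tendsto_nat_floor_atTop (α := ℝ))).const_mul
    (zetaN N 2 * (N : ℝ) ^ 2 / 4))
  -- The two signs of q contribute equal limits, whose sum is the stated constant.
  have e : zetaN N 2 * (N : ℝ) ^ 2 / 4 * (2 / (zetaN N 2 * (N : ℝ) ^ 2) +
      2 / (zetaN N 2 * (N : ℝ) ^ 2)) = 1 := by
    field_simp; norm_num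
  rw [e] at h
  refine h.congr fun T => ?_
  simp only [Function.comp, Pi.div_apply, ncard_approxVectors, Finset.sum_add_distrib]
  rw [← add_div, div_mul_eq_div_div_swap, mul_comm, div_mul_eq_mul_div, mul_comm]
  simp only [div_eq_mul_inv, mul_inv, inv_inv]
  ring
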